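/- Binary codes. A binary linear code is a subspace $C\subseteq \mathrm{GF}(2)^E$, $E$ a finite set; its rate is $\dim C/|E|$. A codeword $c$ is sent through a binary symmetric channel of bit-error rate $p\in(0,\frac12)$; when $x$ is received, maximum-likelihood decoding makes an error if $c$ is not the unique codeword of highest likelihood given $x$. The probability of such an error depends only on $C$ and $p$, not on $c$. For a class $\mathcal C$ of binary linear codes and $R\in(0,1)$, the threshold $\theta_{\mathcal C}(R)$ is the unique $\theta\in[0,\frac12]$ such that (i) for each $p\in(0,\theta)$ and $\varepsilon>0$ there is a code in $\mathcal C$ of rate at least $R$ whose probability of a decoding error at bit-error rate $p$ is at most $\varepsilon$; and (ii) for each $p\in(\theta,\frac12)$ there is $\varepsilon>0$ such that every code in $\mathcal C$ of rate at least $R$ has probability of a decoding error at bit-error rate $p$ at least $\varepsilon$. Cycle codes. The cycle code of a finite graph $G=(V,E)$ (loops and parallel edges allowed) is the subspace of $\mathrm{GF}(2)^E$ of characteristic vectors of edge sets of even subgraphs of $G$. Let $\mathcal G$ be the class of all cycle codes of finite graphs. Non-backtracking matrices. For a finite simple connected graph $G$ of minimum degree at least $2$, let $B(G)$ be the $0/1$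 matrix indexed by the arcs of $G$ (ordered pairs of adjacent vertices) with $B_{(u,v),(u',v')}=1$ if and only if $u'=v$ and $u\neq v'$. Let $\lambda_*(B(G))$ be its Perron eigenvalue: the positive real eigenvalue that has an entrywise positive eigenvector and is at least $|z|$ for every complex eigenvalue $z$. For real $\mu\ge 2$ let $\lambda_*(\mu;n)$ be the infimum of $\lambda_*(B(G))$ over all simple connected graphs $G$ on $n$ vertices with average degree at least $\mu$ and minimum degree at least $2$ (there are such graphs for every integer $n\ge\mu+1$), and let $\lambda_*(\mu)=\liminf_{n\to\infty}\lambda_*(\mu;n)$. Theorem. For every $R\in(0,1)$, the threshold $\theta_{\mathcal G}(R)$ exists, is unique, and satisfies \[\theta_{\mathcal G}(R)\le \tfrac12\Bigl(1-\sqrt{1-\tfrac1{\lambda^2}}\Bigr),\qquad \lambda=\lambda_*\Bigl(\tfrac{2}{1-R}\Bigr).\] -/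

import Mathlib

open scoped Matrix

noncomputable section

namespace CycleCodeThreshold

/-! ### Binary linear codes and maximum-likelihood decoding -/

/-- A binary linear code: a subspace of `GF(2)^ι` for a finite set `ι` of coordinates. -/
structure BinaryLinearCode where
  /-- the set of coordinates -/
  ι : Type
  /-- there are finitely many coordinates -/
  [fintype : Fintype ι]
  /-- the space of codewords -/
  code : Submodule (ZMod 2) (ι → ZMod 2)

attribute [instance] BinaryLinearCode.fintype

/-- The rate `k / n` of a `k`-dimensional code of length `n`. -/
def BinaryLinearCode.rate (C : BinaryLinearCode) : ℝ :=
  (Module.finrank (ZMod 2) C.code : ℝ) / (Fintype.card C.ι : ℝ)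

/-- The probability that the binary symmetric channel of bit-error rate `p` outputs `x`
when `c` is transmitted: each entry is switched independently with probability `p`. -/
def channelProb {ι : Type} [Fintype ι] (p : ℝ) (c x : ι → ZMod 2) : ℝ :=
  ∏ i, if x i = c i then 1 - p else p

/-- When `c` is sent and `x` is received, maximum-likelihood decoding makes an error if `c` is
not the unique codeword of highest likelihood, i.e. if some other codeword is at least as likely. -/
def BinaryLinearCode.IsDecodingError (C : BinaryLinearCode) (p : ℝ) (c x : C.ι → ZMod 2) : Prop :=
  ∃ c' ∈ C.code, c' ≠ c ∧ channelProb p c x ≤ channelProb p c' x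

open Classical in
/-- The probability of an error in maximum-likelihood decoding when `c` is transmitted. -/
def BinaryLinearCode.mlErrorProb (C : BinaryLinearCode) (p : ℝ) (c : C.ι → ZMod 2) : ℝ :=
  ∑ x : C.ι → ZMod 2 with C.IsDecodingError p c x, channelProb p c x

/-- `θ` is the maximum-likelihood decoding threshold of the class `𝒞` of codes at the rate `R`.
(The error probability does not depend on the transmitted codeword `c`.) -/
structure IsMLThreshold (𝒞 : Set BinaryLinearCode) (R θ : ℝ) : Prop where
  mem_Icc : θ ∈ Set.Icc (0 : ℝ) (1 / 2)
  below : ∀ p ∈ Set.Ioo 0 θ, ∀ ε > 0, ∃ C ∈ 𝒞, R ≤ C.rate ∧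
    ∀ c ∈ C.code, C.mlErrorProb p c ≤ ε
  above : ∀ p ∈ Set.Ioo θ (1 / 2), ∃ ε > 0, ∀ C ∈ 𝒞, R ≤ C.rate →
    ∀ c ∈ C.code, ε ≤ C.mlErrorProb p c

/-! ### Cycle codes of graphs -/

open Classical in
/-- The cycle code of a graph (loops and parallel edges allowed) with edges labelled by `ι`:
the characteristic vectors of the edge sets meeting every vertex in an even number of
edge ends. A loop contributes two ends to its vertex, hence nothing modulo 2. -/
def cycleCode {V ι : Type} [Fintype ι] (G : Graph V ι) : Submodule (ZMod 2) (ι → ZMod 2) where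
  carrier := {x | ∀ v : V, ∑ e : ι with G.IsNonloopAt e v, x e = 0}
  zero_mem' := by simp
  add_mem' := by
    intro x y hx hy v
    simp only [Pi.add_apply, Finset.sum_add_distrib, hx v, hy v, add_zero]
  smul_mem' := by
    intro a x hx v
    simp only [Pi.smul_apply, ← Finset.smul_sum, hx v, smul_zero]

/-- The class of cycle codes of finite graphs. -/
def cycleCodes : Set BinaryLinearCode :=
  {C | ∃ (V : Type) (G : Graph V C.ι), G.vertexSet.Finite ∧ G.edgeSet = Set.univ ∧
    C.code = cycleCode G}

/-! ### Non-backtracking matrices -/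

open Classical in
/-- The non-backtracking matrix of a simple graph, indexed by its arcs: the entry at
`((u, v), (u', v'))` is `1` if `u' = v` and `u ≠ v'`, and `0` otherwise. -/
def nonBacktrackingMatrix {V : Type} (G : SimpleGraph V) : Matrix G.Dart G.Dart ℝ :=
  Matrix.of fun e f => if f.fst = e.snd ∧ e.fst ≠ f.snd then 1 else 0

/-- `l` is the Perron eigenvalue of the real square matrix `B`: a positive real eigenvalue with
an entrywise positive eigenvector, at least as large in modulus as every complex eigenvalue. -/
structure IsPerronEigenvalue {m : Type} [Fintype m] [DecidableEq m]
    (B : Matrix m m ℝ) (l : ℝ) : Prop where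
  pos : 0 < l
  exists_eigenvector : ∃ w : m → ℝ, (∀ i, 0 < w i) ∧ B *ᵥ w = l • w
  dominates : ∀ z : ℂ,
    Module.End.HasEigenvalue (Matrix.toLin' (B.map (fun t : ℝ => (t : ℂ)))) z → ‖z‖ ≤ l

open Classical in
/-- The class of connected simple graphs on `n` vertices with average degree at least `μ` and
minimum degree at least `2`. -/
def denseGraphs (μ : ℝ) (n : ℕ) : Set (SimpleGraph (Fin n)) :=
  {G | G.Connected ∧ μ ≤ (∑ v, (G.degree v : ℝ)) / n ∧ ∀ v, 2 ≤ G.degree v}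

open Classical in
/-- `λ_*(μ; n)`: the infimum of the Perron eigenvalues of the non-backtracking matrices of the
graphs in `denseGraphs μ n`. -/
def lambdaStarAt (μ : ℝ) (n : ℕ) : ℝ :=
  sInf {l | ∃ G ∈ denseGraphs μ n, IsPerronEigenvalue (nonBacktrackingMatrix G) l}

/-- `λ_*(μ) = liminf_{n → ∞} λ_*(μ; n)`. -/
def lambdaStar (μ : ℝ) : ℝ :=
  Filter.liminf (fun n : ℕ => lambdaStarAt μ n) Filter.atTop

end CycleCodeThreshold

end

open scoped Matrix

noncomputable section

namespace CycleCodeThreshold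

open Classical

/-! By linearity, decoding fails exactly when some nonzero codeword has nonnegative `excess`: on its
support the error word has at least as many errors as correct entries. This event becomes likelier
as p grows (`prodMass_heavySet_mono`), so for every class of codes the threshold exists as a
supremum.

The claimed bound is the smaller root of 4p(1-p) = 1/λ². So it suffices to bound the failure
probability below, uniformly over cycle codes of rate at least R, whenever 2λ√(p(1-p)) > 1. Follow
non-backtracking walks in a graph, letting a height rise by one across an erroneous edge and fall by
one across a correct one. The walks multiply at the Perron rate of B(G), while the height process
killed outside 0, ..., H decays at a rate close to 2√(p(1-p)). For large H this branching is
supercritical and survives with probability bounded below independently of G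
(`le_prodMass_of_supercritical`). As the graph is finite, survival forces a return to a visited
vertex, and since all heights are bounded, the cycle so closed has excess at least -(2H+5). Running
this at a rate p' < p and sprinkling further errors up to p repairs the bounded deficiency at the
cost of a constant factor (`pow_mul_prodMass_heavySet_le`).

The number λ_* only controls large simple connected graphs of minimum degree two. If the code has a
nonzero word of weight at most L, that word alone causes failure with probability at least p^L.
Otherwise take a smallest nonempty edge set of rate at least R: it is connected and bridgeless, and
contracting about 1/R of its edges brings the average degree up to 2/(1-R). The absence of short
cycles keeps the contraction simple and large, and its cycles lift by adding boundedly many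
contracted edges (`exists_dense_contraction`). Perron-Frobenius theory (`exists_isPerronEigenvalue`,
`forward_closed_eq_univ`) supplies the positive eigenvector that weights the branching process. -/

/-! ### Product measures on binary words -/

/-- The weight of a binary symbol under the error distribution with bit-error rate `p`. -/
def errWeight (p : ℝ) (a : ZMod 2) : ℝ := if a = 0 then 1 - p else p

/-- The mass of a set of binary words under the product of the weights `W i`. -/
def prodMass {ι : Type} [Fintype ι] (W : ι → ZMod 2 → ℝ) (A : Set (ι → ZMod 2)) : ℝ :=
  ∑ x : ι → ZMod 2 with x ∈ A, ∏ i, W i (x i)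

lemma zmod_two_sum {M : Type*} [AddCommMonoid M] (f : ZMod 2 → M) : ∑ a, f a = f 0 + f 1 :=
  Fin.sum_univ_two f

lemma zmod_two_cases (a : ZMod 2) : a = 0 ∨ a = 1 := by
  revert a; decide

lemma errWeight_nonneg {p : ℝ} (h0 : 0 ≤ p) (h1 : p ≤ 1) (a : ZMod 2) : 0 ≤ errWeight p a := by
  unfold errWeight; split_ifs <;> linarith

section ProdMass

variable {ι : Type} [Fintype ι]

lemma sum_prod_weight (W : ι → ZMod 2 → ℝ) :
    ∑ x : ι → ZMod 2, ∏ i, W i (x i) = ∏ i, ∑ a, W i a := by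
  rw [Finset.prod_univ_sum]; simp

lemma prodMass_nonneg {W : ι → ZMod 2 → ℝ} (hW : ∀ i a, 0 ≤ W i a) (A : Set (ι → ZMod 2)) :
    0 ≤ prodMass W A :=
  Finset.sum_nonneg fun _ _ => Finset.prod_nonneg fun _ _ => hW _ _

lemma prodMass_mono {W : ι → ZMod 2 → ℝ} (hW : ∀ i a, 0 ≤ W i a) {A B : Set (ι → ZMod 2)}
    (h : A ⊆ B) : prodMass W A ≤ prodMass W B := by
  refine Finset.sum_le_sum_of_subset_of_nonneg ?_ fun _ _ _ => Finset.prod_nonneg fun _ _ => hW _ _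
  intro x; simp only [Finset.mem_filter]; exact fun hx => ⟨hx.1, h hx.2⟩

/-- If all words of positive weight lie in `A` and the weights are normalised, `A` has mass one. -/
lemma prodMass_eq_one {W : ι → ZMod 2 → ℝ} (hW : ∀ i, ∑ a, W i a = 1) {A : Set (ι → ZMod 2)}
    (h : ∀ x, (∀ i, W i (x i) ≠ 0) → x ∈ A) : prodMass W A = 1 := by
  have : prodMass W A = ∑ x : ι → ZMod 2, ∏ i, W i (x i) := by
    rw [prodMass]
    refine Finset.sum_filter_of_ne fun x _ hx => h x fun i hi => hx ?_
    exact Finset.prod_eq_zero (Finset.mem_univ i) hi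
  rw [this, sum_prod_weight]; simp [hW]

/-- Conditioning on one coordinate: a revealed coordinate carries a point mass. This drives the
exploration below, which reveals edges one at a time. -/
lemma prodMass_update (W : ι → ZMod 2 → ℝ) (A : Set (ι → ZMod 2)) (i : ι) (p : ℝ)
    (hi : W i = errWeight p) :
    prodMass W A = p * prodMass (Function.update W i (Pi.single 1 1)) A +
      (1 - p) * prodMass (Function.update W i (Pi.single 0 1)) A := by
  simp only [prodMass, Finset.mul_sum]
  rw [← Finset.sum_add_distrib]
  refine Finset.sum_congr rfl fun x _ => ?_
  have key : ∀ V : ι → ZMod 2 → ℝ, ∏ j, V j (x j) = V i (x i) * ∏ j ∈ Finset.univ.erase i, V j (x j) :=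
    fun V => (Finset.mul_prod_erase _ _ (Finset.mem_univ i)).symm
  have hc : ∀ f : ZMod 2 → ℝ, ∏ j ∈ Finset.univ.erase i, Function.update W i f j (x j) =
      ∏ j ∈ Finset.univ.erase i, W j (x j) := fun f =>
    Finset.prod_congr rfl fun j hj => by rw [Function.update_of_ne (Finset.ne_of_mem_erase hj)]
  rw [key W, key (Function.update W i (Pi.single 1 1)), key (Function.update W i (Pi.single 0 1)),
    hc, hc, hi]
  simp only [Function.update_self]
  rcases zmod_two_cases (x i) with h | h <;> simp [h, errWeight]

/-- The mass of a cylinder set. -/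
lemma prodMass_cylinder (r : ℝ) (T : Finset ι) :
    prodMass (fun _ => errWeight r) {y : ι → ZMod 2 | ∀ i ∈ T, y i ≠ 0} = r ^ T.card := by
  have : prodMass (fun _ => errWeight r) {y : ι → ZMod 2 | ∀ i ∈ T, y i ≠ 0} =
      ∑ y : ι → ZMod 2, ∏ i, (if i ∈ T ∧ y i = 0 then 0 else errWeight r (y i)) := by
    rw [prodMass, Finset.sum_filter]
    refine Finset.sum_congr rfl fun y _ => ?_
    split_ifs with h
    · refine Finset.prod_congr rfl fun i _ => ?_
      rw [if_neg]; rintro ⟨h1, h2⟩; exact h i h1 h2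
    · simp only [Set.mem_ofPred_eq, not_forall, not_not] at h
      obtain ⟨i, hi, hy⟩ := h
      exact (Finset.prod_eq_zero (Finset.mem_univ i) (by simp [hi, hy])).symm
  rw [this, sum_prod_weight (fun i a => if i ∈ T ∧ a = 0 then 0 else errWeight r a)]
  have h2 : ∀ i, ∑ a : ZMod 2, (if i ∈ T ∧ a = 0 then 0 else errWeight r a) = if i ∈ T then r else 1 := by
    intro i; rw [zmod_two_sum]; by_cases hi : i ∈ T <;> simp [hi, errWeight]
  simp_rw [h2]
  rw [Finset.prod_ite]; simp

/-- The coordinatewise disjunction of binary words. -/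
def wordOr (x y : ι → ZMod 2) : ι → ZMod 2 := fun i => if x i = 0 then y i else x i

/-- A word of bit-error rate `p + (1 - p) r` is the disjunction of independent words of bit-error
rates `p` and `r`. -/
lemma prodMass_wordOr (p r : ℝ) (A : Set (ι → ZMod 2)) :
    prodMass (fun _ => errWeight (p + (1 - p) * r)) A =
      ∑ x : ι → ZMod 2, (∏ i, errWeight p (x i)) *
        prodMass (fun _ => errWeight r) {y | wordOr x y ∈ A} := by
  have h1 : ∀ z : ι → ZMod 2, ∏ i, errWeight (p + (1 - p) * r) (z i) =
      ∑ x : ι → ZMod 2, ∑ y : ι → ZMod 2,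
        (if wordOr x y = z then 1 else 0) * ((∏ i, errWeight p (x i)) * ∏ i, errWeight r (y i)) := by
    intro z
    have h2 : ∀ i, errWeight (p + (1 - p) * r) (z i) = ∑ a : ZMod 2, ∑ b : ZMod 2,
        (if (if a = 0 then b else a) = z i then 1 else 0) * (errWeight p a * errWeight r b) := by
      intro i
      simp only [zmod_two_sum]
      rcases zmod_two_cases (z i) with h | h <;> simp [h, errWeight] <;> ring
    simp_rw [h2]
    rw [← sum_prod_weight (fun i a => ∑ b : ZMod 2,
        (if (if a = 0 then b else a) = z i then 1 else 0) * (errWeight p a * errWeight r b))]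
    refine Finset.sum_congr rfl fun x _ => ?_
    rw [← sum_prod_weight (fun i b =>
        (if (if x i = 0 then b else x i) = z i then 1 else 0) * (errWeight p (x i) * errWeight r b))]
    refine Finset.sum_congr rfl fun y _ => ?_
    rw [Finset.prod_mul_distrib, Finset.prod_mul_distrib]
    congr 1
    split_ifs with h
    · exact Finset.prod_eq_one fun i _ => if_pos (congrFun h i)
    · obtain ⟨i, hi⟩ := Function.ne_iff.mp h
      exact Finset.prod_eq_zero (Finset.mem_univ i) (if_neg hi)
  rw [prodMass]
  simp_rw [h1]
  rw [Finset.sum_comm]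
  refine Finset.sum_congr rfl fun x _ => ?_
  rw [Finset.sum_comm, prodMass, Finset.mul_sum, Finset.sum_filter]
  refine Finset.sum_congr rfl fun y _ => ?_
  rw [← Finset.sum_mul, Finset.sum_ite_eq]
  simp only [Finset.mem_filter, Finset.mem_univ, true_and, Set.mem_ofPred_eq]
  split_ifs <;> simp

end ProdMass

/-! ### Heavy codewords and decoding errors -/

section Heavy

variable {ι : Type} [Fintype ι]

/-- The number of errors minus the number of correct entries of `x` on the support of `z`. -/
def excess (x z : ι → ZMod 2) : ℤ := ∑ i with z i ≠ 0, if x i = 0 then -1 else 1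

/-- The error words for which a nonzero codeword has excess at least `-M`. -/
def heavySet (C : Submodule (ZMod 2) (ι → ZMod 2)) (M : ℕ) : Set (ι → ZMod 2) :=
  {x | ∃ z ∈ C, z ≠ 0 ∧ -(M : ℤ) ≤ excess x z}

lemma excess_eq (x z : ι → ZMod 2) : excess x z =
    ((Finset.univ.filter fun i => z i ≠ 0 ∧ x i ≠ 0).card : ℤ) -
      (Finset.univ.filter fun i => z i ≠ 0 ∧ x i = 0).card := by
  rw [excess, Finset.sum_ite, Finset.filter_filter, Finset.filter_filter]
  simp; ring

/-- Adding z to x corrects the errors on the support of z and spoils the correct entries there.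
Hence z is at least as near to x as 0 is exactly when the excess is nonnegative. -/
lemma hammingDist_add_excess (x z : ι → ZMod 2) :
    (hammingDist x z : ℤ) + excess x z = hammingNorm x := by
  rw [hammingDist, hammingNorm, excess, Finset.card_filter, Finset.card_filter, Finset.sum_filter]
  push_cast
  rw [← Finset.sum_add_distrib]
  refine Finset.sum_congr rfl fun i _ => ?_
  generalize x i = a
  generalize z i = b
  revert a b; decide

lemma channelProb_eq {p : ℝ} (hp1 : p < 1) (c x : ι → ZMod 2) :
    channelProb p c x = (1 - p) ^ Fintype.card ι * (p / (1 - p)) ^ hammingDist x c := by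
  have : (1 - p) ≠ 0 := by linarith
  rw [channelProb, hammingDist, Finset.card_filter, ← Finset.prod_pow_eq_pow_sum, Fintype.card,
    ← Finset.prod_const, ← Finset.prod_mul_distrib]
  refine Finset.prod_congr rfl fun i _ => ?_
  by_cases h : x i = c i
  · simp [h]
  · simp [h]; field_simp

lemma channelProb_le_iff {p : ℝ} (hp : 0 < p) (hp1 : p < 1 / 2) (c c' x : ι → ZMod 2) :
    channelProb p c x ≤ channelProb p c' x ↔ hammingDist x c' ≤ hammingDist x c := by
  rw [channelProb_eq (by linarith), channelProb_eq (by linarith),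
    mul_le_mul_iff_right₀ (pow_pos (by linarith) _)]
  exact pow_le_pow_iff_right_of_lt_one₀ (div_pos hp (by linarith))
    ((div_lt_one (by linarith)).2 (by linarith))

/-- Translation by c reduces to the zero codeword, with error word x - c; for p < 1/2 likelihood is
decreasing in Hamming distance. -/
lemma isDecodingError_iff (C : BinaryLinearCode) {p : ℝ} (hp : 0 < p) (hp1 : p < 1 / 2)
    {c : C.ι → ZMod 2} (hc : c ∈ C.code) (x : C.ι → ZMod 2) :
    C.IsDecodingError p c x ↔ x - c ∈ heavySet C.code 0 := by
  have key : ∀ z, hammingDist x (z + c) ≤ hammingDist x c ↔ -((0 : ℕ) : ℤ) ≤ excess (x - c) z := by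
    intro z
    have h1 := hammingDist_add_excess (x - c) z
    rw [← hammingDist_zero_right] at h1
    have h2 : hammingDist x (z + c) = hammingDist (x - c) z := by
      simp only [hammingDist, Pi.sub_apply, Pi.add_apply, ne_eq, sub_eq_iff_eq_add]
    have h3 : hammingDist x c = hammingDist (x - c) 0 := by
      simp only [hammingDist, Pi.sub_apply, Pi.zero_apply, ne_eq, sub_eq_zero]
    rw [h2, h3]; push_cast; omega
  constructor
  · rintro ⟨c', hc', hne, h⟩
    rw [channelProb_le_iff hp hp1] at h
    refine ⟨c' - c, C.code.sub_mem hc' hc, sub_ne_zero.2 hne, ?_⟩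
    rw [← key, sub_add_cancel]; exact h
  · rintro ⟨z, hz, hne, h⟩
    refine ⟨z + c, C.code.add_mem hz hc, by simpa using hne, ?_⟩
    rw [channelProb_le_iff hp hp1, key]; exact h

/-- The error probability does not depend on the transmitted codeword. -/
lemma mlErrorProb_eq (C : BinaryLinearCode) {p : ℝ} (hp : 0 < p) (hp1 : p < 1 / 2)
    {c : C.ι → ZMod 2} (hc : c ∈ C.code) :
    C.mlErrorProb p c = prodMass (fun _ => errWeight p) (heavySet C.code 0) := by
  rw [BinaryLinearCode.mlErrorProb, prodMass, Finset.sum_filter, Finset.sum_filter]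
  refine Fintype.sum_equiv (Equiv.subRight c) _ _ fun x => ?_
  simp only [isDecodingError_iff C hp hp1 hc, Equiv.subRight_apply]
  refine if_congr Iff.rfl ?_ rfl
  simp only [channelProb, errWeight, Pi.sub_apply, sub_eq_zero]

/-- Sprinkling further errors turns a codeword of excess at least `-M` into one of nonnegative
excess. -/
lemma pow_mul_prodMass_heavySet_le (C : Submodule (ZMod 2) (ι → ZMod 2)) (M : ℕ) {p r : ℝ}
    (hp0 : 0 ≤ p) (hp1 : p ≤ 1) (hr0 : 0 ≤ r) (hr1 : r ≤ 1) :
    r ^ M * prodMass (fun _ => errWeight p) (heavySet C M) ≤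
      prodMass (fun _ => errWeight (p + (1 - p) * r)) (heavySet C 0) := by
  rw [prodMass_wordOr, prodMass, Finset.mul_sum, Finset.sum_filter]
  refine Finset.sum_le_sum fun x _ => ?_
  have hx0 : 0 ≤ ∏ i, errWeight p (x i) := Finset.prod_nonneg fun i _ => errWeight_nonneg hp0 hp1 _
  split_ifs with hx
  · rw [mul_comm]
    refine mul_le_mul_of_nonneg_left ?_ hx0
    obtain ⟨z, hz, hz0, hex⟩ := hx
    rw [excess_eq] at hex
    -- It is enough to spoil M correct entries on the support of z, or all of them if there are
    -- fewer: in the latter case no correct entry remains and the excess is trivially nonnegative.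
    obtain ⟨T, hTsub, hTc⟩ := Finset.exists_subset_card_eq
      (show min M (Finset.univ.filter fun i => z i ≠ 0 ∧ x i = 0).card ≤
        (Finset.univ.filter fun i => z i ≠ 0 ∧ x i = 0).card from min_le_right _ _)
    refine le_trans ?_ (prodMass_mono (fun _ => errWeight_nonneg hr0 hr1)
      (A := {y | ∀ i ∈ T, y i ≠ 0}) ?_)
    · rw [prodMass_cylinder]
      exact pow_le_pow_of_le_one hr0 hr1 (by rw [hTc]; exact min_le_left _ _)
    · intro y hy
      refine ⟨z, hz, hz0, ?_⟩
      rw [excess_eq]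
      have h1 : (Finset.univ.filter fun i => z i ≠ 0 ∧ x i ≠ 0).card ≤
          (Finset.univ.filter fun i => z i ≠ 0 ∧ wordOr x y i ≠ 0).card := by
        refine Finset.card_le_card fun i => ?_
        simp only [Finset.mem_filter, Finset.mem_univ, true_and]
        rintro ⟨h1, h2⟩
        refine ⟨h1, ?_⟩
        rw [wordOr, if_neg h2]; exact h2
      have h2 : (Finset.univ.filter fun i => z i ≠ 0 ∧ wordOr x y i = 0) ⊆
          (Finset.univ.filter fun i => z i ≠ 0 ∧ x i = 0) \ T := by
        intro i
        simp only [Finset.mem_filter, Finset.mem_univ, true_and, Finset.mem_sdiff]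
        rintro ⟨h1, h2⟩
        rw [wordOr] at h2
        split_ifs at h2 with h3
        · exact ⟨⟨h1, h3⟩, fun h4 => hy i h4 h2⟩
        · exact absurd h2 h3
      have h3 := Finset.card_le_card h2
      rw [Finset.card_sdiff_of_subset hTsub, hTc] at h3
      push_cast
      omega
  · exact mul_nonneg hx0 (prodMass_nonneg (fun _ => errWeight_nonneg hr0 hr1) _)

/-- The sprinkling bound with M = 0, where r = (p' - p)/(1 - p) solves p + (1 - p) r = p'. -/
lemma prodMass_heavySet_mono (C : Submodule (ZMod 2) (ι → ZMod 2)) {p p' : ℝ}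
    (hp0 : 0 ≤ p) (hpp : p ≤ p') (hp1 : p' < 1) :
    prodMass (fun _ => errWeight p) (heavySet C 0) ≤
      prodMass (fun _ => errWeight p') (heavySet C 0) := by
  have h1 : 0 < 1 - p := by linarith
  have := pow_mul_prodMass_heavySet_le C 0 hp0 (by linarith)
    (div_nonneg (sub_nonneg.2 hpp) h1.le) ((div_le_one h1).2 (by linarith))
  rw [pow_zero, one_mul, mul_div_cancel₀ _ h1.ne', add_sub_cancel] at this
  exact this

/-- A codeword of weight at most `L` is all in error with probability at least `p ^ L`. -/
lemma pow_le_prodMass_heavySet (C : Submodule (ZMod 2) (ι → ZMod 2)) {p : ℝ} (hp0 : 0 ≤ p)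
    (hp1 : p ≤ 1) {L : ℕ} {z : ι → ZMod 2} (hz : z ∈ C) (hz0 : z ≠ 0) (hL : hammingNorm z ≤ L) :
    p ^ L ≤ prodMass (fun _ => errWeight p) (heavySet C 0) := by
  refine le_trans (pow_le_pow_of_le_one hp0 hp1 hL) ?_
  rw [hammingNorm, ← prodMass_cylinder]
  refine prodMass_mono (fun _ => errWeight_nonneg hp0 hp1) fun x hx => ⟨z, hz, hz0, ?_⟩
  rw [excess]
  push_cast
  rw [neg_zero]
  refine Finset.sum_nonneg fun i hi => ?_
  rw [if_neg (hx i hi)]; norm_num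

end Heavy

/-! ### Existence and uniqueness of thresholds -/

/-- Only monotonicity in p is used: the rates at which arbitrarily reliable codes exist form an
initial segment of (0, 1/2), and θ is its supremum. -/
theorem existsUnique_isMLThreshold (𝒞 : Set BinaryLinearCode) (R : ℝ) :
    ∃! θ : ℝ, IsMLThreshold 𝒞 R θ := by
  set S : Set ℝ := {p | p ∈ Set.Ioo (0 : ℝ) (1 / 2) ∧ ∀ ε > 0, ∃ C ∈ 𝒞, R ≤ C.rate ∧
    ∀ c ∈ C.code, C.mlErrorProb p c ≤ ε} with hS
  -- The point 0 is inserted because `S` may be empty, in which case the threshold is 0.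
  have hbdd : BddAbove (insert 0 S) := by
    refine ⟨1 / 2, ?_⟩
    rintro p (rfl | hp)
    · norm_num
    · exact hp.1.2.le
  have hex : IsMLThreshold 𝒞 R (sSup (insert 0 S)) := by
    refine ⟨⟨le_csSup hbdd (Set.mem_insert _ _), csSup_le ⟨0, Set.mem_insert _ _⟩ ?_⟩, ?_, ?_⟩
    · rintro p (rfl | hp)
      · norm_num
      · exact hp.1.2.le
    · rintro p ⟨hp0, hp⟩ ε hε
      obtain ⟨p', hp', hlt⟩ := exists_lt_of_lt_csSup ⟨0, Set.mem_insert _ _⟩ hp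
      rcases hp' with rfl | hp'
      · exact absurd hlt (not_lt.2 hp0.le)
      obtain ⟨C, hC, hR, h⟩ := hp'.2 ε hε
      refine ⟨C, hC, hR, fun c hc => ?_⟩
      refine le_trans ?_ (h c hc)
      rw [mlErrorProb_eq C hp0 (by linarith [hp'.1.2]) hc, mlErrorProb_eq C hp'.1.1 hp'.1.2 hc]
      exact prodMass_heavySet_mono _ hp0.le hlt.le (by linarith [hp'.1.2])
    · rintro p ⟨hp0, hp⟩
      have h0 : 0 < p := lt_of_le_of_lt (le_csSup hbdd (Set.mem_insert _ _)) hp0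
      have hnot : p ∉ S := fun h => absurd (le_csSup hbdd (Set.mem_insert_of_mem _ h)) (not_le.2 hp0)
      have : ¬ ∀ ε > 0, ∃ C ∈ 𝒞, R ≤ C.rate ∧ ∀ c ∈ C.code, C.mlErrorProb p c ≤ ε :=
        fun h => hnot ⟨⟨h0, hp⟩, h⟩
      push Not at this
      obtain ⟨ε, hε, h⟩ := this
      -- The negation yields one bad codeword per code; all codewords have the same error
      -- probability.
      refine ⟨ε, hε, fun C hC hR c hc => ?_⟩
      obtain ⟨c', hc', h'⟩ := h C hC hR
      rw [mlErrorProb_eq C h0 hp hc, ← mlErrorProb_eq C h0 hp hc']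
      exact h'.le
  refine ⟨_, hex, ?_⟩
  have hle : ∀ θ θ' : ℝ, IsMLThreshold 𝒞 R θ → IsMLThreshold 𝒞 R θ' → θ ≤ θ' := by
    intro θ θ' h h'
    by_contra! hlt
    obtain ⟨p, hp1, hp2⟩ := exists_between hlt
    have hp0 : 0 < p := lt_of_le_of_lt h'.mem_Icc.1 hp1
    obtain ⟨ε, hε, hab⟩ := h'.above p ⟨hp1, lt_of_lt_of_le hp2 h.mem_Icc.2⟩
    obtain ⟨C, hC, hR, hbe⟩ := h.below p ⟨hp0, hp2⟩ (ε / 2) (by linarith)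
    linarith [hab C hC hR 0 C.code.zero_mem, hbe 0 C.code.zero_mem]
  intro θ hθ
  exact le_antisymm (hle _ _ hθ hex) (hle _ _ hex hθ)

/-! ### Boundaries modulo two -/

section Boundary

variable {ι V : Type} [Fintype ι]

/-- The boundary modulo 2 of an edge set, where the edge `e` has the ends `s e` and `t e`. -/
def boundary (s t : ι → V) : (ι → ZMod 2) →ₗ[ZMod 2] (V → ZMod 2) where
  toFun x v := ∑ e, x e * ((if s e = v then 1 else 0) + (if t e = v then 1 else 0))
  map_add' x y := by
    funext v; simp only [Pi.add_apply, add_mul, Finset.sum_add_distrib]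
  map_smul' a x := by
    funext v; simp only [Pi.smul_apply, smul_eq_mul, mul_assoc, Finset.mul_sum, RingHom.id_apply]

lemma boundary_apply (s t : ι → V) (x : ι → ZMod 2) (v : V) : boundary s t x v =
    ∑ e, x e * ((if s e = v then 1 else 0) + (if t e = v then 1 else 0)) := rfl

lemma boundary_single (s t : ι → V) (e : ι) :
    boundary s t (Pi.single e 1) = Pi.single (s e) 1 + Pi.single (t e) 1 := by
  funext v
  rw [boundary_apply, Finset.sum_eq_single e]
  · simp [Pi.single_apply, eq_comm]
  · intro e' _ h; simp [h]
  · simp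

lemma add_self_zmod_two (f : V → ZMod 2) : f + f = 0 := by
  funext v; exact CharTwo.add_self_eq_zero _

lemma excess_congr {x x' y : ι → ZMod 2} (h : ∀ e, y e ≠ 0 → x e = x' e) :
    excess x y = excess x' y := by
  rw [excess, excess]
  refine Finset.sum_congr rfl fun e he => ?_
  rw [h e (Finset.mem_filter.1 he).2]

lemma excess_add_single (x : ι → ZMod 2) {y : ι → ZMod 2} {e : ι} (he : y e = 0) :
    excess x (y + Pi.single e 1) = excess x y + if x e = 0 then -1 else 1 := by
  rw [excess, excess]
  have : (Finset.univ.filter fun i => (y + Pi.single e 1 : ι → ZMod 2) i ≠ 0) =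
      insert e (Finset.univ.filter fun i => y i ≠ 0) := by
    ext i
    by_cases hi : i = e
    · subst hi; simp [he]
    · simp [hi]
  rw [this, Finset.sum_insert (by simp [he]), add_comm]

end Boundary

/-! ### Exploring a graph by branching -/

section Exploration

variable {ι V : Type} {G : SimpleGraph V}

/-- The darts that may follow `d` in a non-backtracking walk. -/
def succDarts [Fintype V] (d : G.Dart) : Finset G.Dart :=
  Finset.univ.filter fun d' => d'.fst = d.snd ∧ d'.snd ≠ d.fst

/-- The state of an exploration: `X` is the set of visited vertices, `D` the set of revealed edges,
with values `x`, and `Q` the set of darts still to be followed. Each visited vertex `v` has a height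
`h v`, and two visited vertices are joined by a set of revealed edges whose excess is bounded below
in terms of their heights. -/
structure IsExploration [Fintype ι] (s t : ι → V) (lab : G.Dart → ι) (H : ℕ) (X : Finset V) (D : Finset ι)
    (x : ι → ZMod 2) (h : V → ℤ) (Q : Finset G.Dart) : Prop where
  ends_mem : ∀ e ∈ D, s e ∈ X ∧ t e ∈ X
  mem_range : ∀ e ∈ D, e ∈ Set.range lab
  height : ∀ v ∈ X, -1 ≤ h v ∧ h v ≤ H + 1
  joined : ∀ a ∈ X, ∀ b ∈ X, ∃ y : ι → ZMod 2, (∀ e ∉ D, y e = 0) ∧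
    boundary s t y = Pi.single a 1 + Pi.single b 1 ∧ h a + h b - 2 * (H + 1) ≤ excess x y
  pending : ∀ d ∈ Q, d.fst ∈ X ∧ lab d ∉ D ∧ 0 ≤ h d.fst ∧ h d.fst ≤ H

lemma dart_ends {s t : ι → V} {lab : G.Dart → ι} (hlab : ∀ d, s(s (lab d), t (lab d)) = d.edge)
    (d : G.Dart) :
    (s (lab d) = d.fst ∧ t (lab d) = d.snd) ∨ (s (lab d) = d.snd ∧ t (lab d) = d.fst) :=
  Sym2.eq_iff.1 (hlab d)

lemma boundary_single_dart [Fintype ι] {s t : ι → V} {lab : G.Dart → ι}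
    (hlab : ∀ d, s(s (lab d), t (lab d)) = d.edge) (d : G.Dart) :
    boundary s t (Pi.single (lab d) 1) = Pi.single d.fst 1 + Pi.single d.snd 1 := by
  rw [boundary_single]
  rcases dart_ends hlab d with ⟨h1, h2⟩ | ⟨h1, h2⟩ <;> rw [h1, h2]
  rw [add_comm]

/-- The path ending at u is prolonged by the fresh edge e, which does not lie on it, so revealing e
leaves the excess of the old path unchanged. The exploration applies this with H + 1 in place of
`H`. -/
lemma joined_insert [Fintype ι] {s t : ι → V} {X : Finset V} {D : Finset ι} {x : ι → ZMod 2} {h : V → ℤ} {H : ℤ}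
    (hj : ∀ a ∈ X, ∀ b ∈ X, ∃ y : ι → ZMod 2, (∀ e ∉ D, y e = 0) ∧
      boundary s t y = Pi.single a 1 + Pi.single b 1 ∧ h a + h b - 2 * H ≤ excess x y)
    {u v : V} {e : ι} {a : ZMod 2} (hu : u ∈ X) (he : e ∉ D)
    (hb : boundary s t (Pi.single e 1) = Pi.single u 1 + Pi.single v 1)
    {b : V} (hbX : b ∈ X) :
    ∃ y : ι → ZMod 2, (∀ e' ∉ insert e D, y e' = 0) ∧
      boundary s t y = Pi.single v 1 + Pi.single b 1 ∧
      (h u + if a = 0 then -1 else 1) + h b - 2 * H ≤ excess (Function.update x e a) y := by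
  obtain ⟨y, hy, hyb, hye⟩ := hj u hu b hbX
  refine ⟨y + Pi.single e 1, fun e' he' => ?_, ?_, ?_⟩
  · rw [Finset.mem_insert, not_or] at he'
    simp [hy e' he'.2, he'.1]
  · rw [map_add, hyb, hb]
    calc _ = (Pi.single u 1 + Pi.single u 1) + (Pi.single v 1 + Pi.single b 1) := by abel
      _ = _ := by rw [add_self_zmod_two, zero_add]
  · rw [excess_add_single _ (hy e he), Function.update_self]
    have : excess (Function.update x e a) y = excess x y := excess_congr fun e' he' => by
      rw [Function.update_of_ne]; rintro rfl; exact he' (hy _ he)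
    rw [this]; linarith

/-- Revealing the edge of a pending dart that leads to an unvisited vertex grows the exploration
tree by a leaf. The leaf spawns new darts only if its height is in 0, ..., H; otherwise this branch
is killed. -/
lemma IsExploration.reveal [Fintype ι] [Fintype V] {s t : ι → V} {lab : G.Dart → ι} {H : ℕ} {X : Finset V} {D : Finset ι}
    {x : ι → ZMod 2} {h : V → ℤ} {Q : Finset G.Dart} (hE : IsExploration s t lab H X D x h Q)
    (hlab : ∀ d, s(s (lab d), t (lab d)) = d.edge) {d : G.Dart} (hd : d ∈ Q) (hv : d.snd ∉ X)
    (a : ZMod 2) {k : ℤ} (hk : k = h d.fst + if a = 0 then -1 else 1) :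
    IsExploration s t lab H (insert d.snd X) (insert (lab d) D) (Function.update x (lab d) a)
      (Function.update h d.snd k) (Q.erase d ∪ if 0 ≤ k ∧ k ≤ H then succDarts d else ∅) := by
  obtain ⟨huX, heD, hu0, huH⟩ := hE.pending d hd
  have hends := dart_ends hlab
  have hb := boundary_single_dart hlab d
  have hne : ∀ w ∈ X, w ≠ d.snd := fun w hw h' => hv (h' ▸ hw)
  have hσ : -1 ≤ k ∧ k ≤ H + 1 := by rw [hk]; split_ifs <;> constructor <;> linarith
  refine ⟨?_, ?_, ?_, ?_, ?_⟩
  · intro e he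
    rcases Finset.mem_insert.1 he with rfl | he
    · rcases hends d with ⟨h1, h2⟩ | ⟨h1, h2⟩ <;> rw [h1, h2] <;> simp [huX]
    · exact ⟨Finset.mem_insert_of_mem (hE.ends_mem e he).1,
        Finset.mem_insert_of_mem (hE.ends_mem e he).2⟩
  · intro e he
    rcases Finset.mem_insert.1 he with rfl | he
    · exact ⟨d, rfl⟩
    · exact hE.mem_range e he
  · intro v hvX
    rcases Finset.mem_insert.1 hvX with rfl | hvX
    · rw [Function.update_self]; exact hσ
    · rw [Function.update_of_ne (hne v hvX)]; exact hE.height v hvX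
  · intro b hb' c hc
    rcases Finset.mem_insert.1 hb' with rfl | hbX <;> rcases Finset.mem_insert.1 hc with rfl | hcX
    · refine ⟨0, fun _ _ => rfl, by rw [map_zero, add_self_zmod_two], ?_⟩
      rw [Function.update_self]
      simp only [excess, Pi.zero_apply, ne_eq, not_true_eq_false, Finset.filter_false,
        Finset.sum_empty]
      linarith [hσ.2]
    · rw [Function.update_self, Function.update_of_ne (hne c hcX), hk]
      exact joined_insert hE.joined huX heD hb hcX
    · rw [Function.update_self, Function.update_of_ne (hne b hbX), hk]
      obtain ⟨y, h1, h2, h3⟩ := joined_insert (a := a) hE.joined huX heD hb hbX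
      exact ⟨y, h1, by rw [h2, add_comm], by linarith⟩
    · obtain ⟨y, hy, hyb, hye⟩ := hE.joined b hbX c hcX
      refine ⟨y, fun e he => hy e fun h' => he (Finset.mem_insert_of_mem h'), hyb, ?_⟩
      rw [Function.update_of_ne (hne b hbX), Function.update_of_ne (hne c hcX)]
      have : excess (Function.update x (lab d) a) y = excess x y := excess_congr fun e' he' => by
        rw [Function.update_of_ne]; rintro rfl; exact he' (hy _ heD)
      rw [this]; exact hye
  · intro d' hd'
    rcases Finset.mem_union.1 hd' with hd' | hd'
    · obtain ⟨hne', hdQ⟩ := Finset.mem_erase.1 hd'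
      obtain ⟨h1, h2, h3, h4⟩ := hE.pending d' hdQ
      rw [Function.update_of_ne (hne _ h1)]
      refine ⟨Finset.mem_insert_of_mem h1, ?_, h3, h4⟩
      rw [Finset.mem_insert, not_or]
      refine ⟨fun h' => ?_, h2⟩
      -- A pending dart on the same edge could only be the reverse of `d`, but that one starts at an
      -- unvisited vertex.
      have h5 : d'.edge = d.edge := by rw [← hlab, ← hlab, h']
      rcases (SimpleGraph.dart_edge_eq_iff _ _).1 h5 with h6 | h6
      · exact hne' h6
      · rw [h6] at h1; exact hv h1
    · split_ifs at hd' with hk'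
      · rw [succDarts, Finset.mem_filter] at hd'
        obtain ⟨-, h1, h2⟩ := hd'
        rw [h1, Function.update_self]
        refine ⟨Finset.mem_insert_self _ _, ?_, hk'⟩
        rw [Finset.mem_insert, not_or]
        constructor
        · intro h'
          have h5 : d'.edge = d.edge := by rw [← hlab, ← hlab, h']
          rcases (SimpleGraph.dart_edge_eq_iff _ _).1 h5 with h6 | h6
          · rw [h6] at h1; exact hne _ huX h1
          · rw [h6] at h2; exact h2 rfl
        · intro h'
          have := hE.ends_mem _ h'
          rcases hends d' with ⟨h3, h4⟩ | ⟨h3, h4⟩ <;> rw [h3, h4, h1] at this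
          · exact hv this.1
          · exact hv this.2
      · simp at hd'

/-- The probability that a cycle of bounded deficiency closes is at least the survival probability
of a branching process, started from the darts to be followed. -/
theorem IsExploration.survival_le [Fintype ι] [Fintype V] {s t : ι → V} {lab : G.Dart → ι} {H : ℕ}
    (hlab : ∀ d, s(s (lab d), t (lab d)) = d.edge) {p : ℝ} (hp0 : 0 ≤ p) (hp1 : p ≤ 1)
    {A : Set (ι → ZMod 2)}
    (hA : ∀ x y : ι → ZMod 2, y ≠ 0 → (∀ e ∉ Set.range lab, y e = 0) → boundary s t y = 0 →
      -((2 * H + 5 : ℕ) : ℤ) ≤ excess x y → x ∈ A)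
    {q : G.Dart → ℤ → ℝ} (hq1 : ∀ d k, q d k ≤ 1)
    (hqz : ∀ d (k : ℤ), ¬ (0 ≤ k ∧ k ≤ H) → q d k = 0)
    (hq : ∀ d (k : ℤ), 0 ≤ k → k ≤ H →
      ∏ d' ∈ succDarts d, (1 - (p * q d' (k + 1) + (1 - p) * q d' (k - 1))) ≤ 1 - q d k)
    (n : ℕ) : ∀ {X : Finset V} {D : Finset ι} {x : ι → ZMod 2} {h : V → ℤ} {Q : Finset G.Dart},
    IsExploration s t lab H X D x h Q → (Finset.univ \ X).card = n →
    1 - ∏ d ∈ Q, (1 - (p * q d (h d.fst + 1) + (1 - p) * q d (h d.fst - 1))) ≤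
      prodMass (fun e => if e ∈ D then Pi.single (x e) 1 else errWeight p) A := by
  have hg1 : ∀ d k, 0 ≤ 1 - (p * q d (k + 1) + (1 - p) * q d (k - 1)) := fun d k => by
    nlinarith [hq1 d (k + 1), hq1 d (k - 1)]
  induction n using Nat.strong_induction_on with
  | _ n ih =>
  intro X D x h Q hE hn
  have hW0 : ∀ e a, 0 ≤ (if e ∈ D then Pi.single (x e) 1 else errWeight p : ZMod 2 → ℝ) a := by
    intro e a
    split_ifs
    · rw [Pi.single_apply]; split_ifs <;> norm_num
    · exact errWeight_nonneg hp0 hp1 a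
  rcases Q.eq_empty_or_nonempty with rfl | ⟨d, hd⟩
  · simpa using prodMass_nonneg hW0 A
  obtain ⟨huX, heD, hu0, huH⟩ := hE.pending d hd
  -- A pending dart into a visited vertex closes a cycle, whatever the value of its edge, so the
  -- event is already certain.
  by_cases hv : d.snd ∈ X
  · rw [prodMass_eq_one]
    · have := Finset.prod_nonneg (s := Q) fun d _ => hg1 d (h d.fst)
      linarith
    · intro e
      split_ifs
      · rw [Finset.sum_pi_single']; simp
      · rw [zmod_two_sum]; simp [errWeight]
    · intro x' hx'
      obtain ⟨y, hy, hyb, hye⟩ := hE.joined _ huX _ hv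
      have hb := boundary_single_dart hlab d
      refine hA x' (y + Pi.single (lab d) 1) ?_ ?_ ?_ ?_
      · intro h0
        have := congrFun h0 (lab d)
        simp [hy _ heD] at this
      · intro e he
        have h1 : e ∉ D := fun h' => he (hE.mem_range e h')
        have h2 : e ≠ lab d := fun h' => he ⟨d, h'.symm⟩
        simp [hy e h1, h2]
      · rw [map_add, hyb, hb, add_self_zmod_two]
      · rw [excess_add_single _ (hy _ heD)]
        have h1 : excess x' y = excess x y := excess_congr fun e he => by
          have heD' : e ∈ D := by by_contra h'; exact he (hy e h')
          have := hx' e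
          rw [if_pos heD', Pi.single_apply] at this
          by_contra h'; exact this (if_neg h')
        -- Both heights are at least -1 and the closing edge costs at most 1, giving -2 - 2(H+1) - 1
        -- = -(2H+5).
        have h2 := (hE.height _ huX).1
        have h3 := (hE.height _ hv).1
        rw [h1]; push_cast
        split_ifs <;> linarith
  -- Otherwise condition on the value of the new edge. The failure product over pending darts
  -- factorises, and the subsolution inequality `hq` replaces the factors of the spawned darts by 1
  -- - q.
  · have hstep : ∀ (a : ZMod 2) (k : ℤ), k = (h d.fst + if a = 0 then -1 else 1) →
        1 - (∏ d' ∈ Q.erase d, (1 - (p * q d' (h d'.fst + 1) + (1 - p) * q d' (h d'.fst - 1)))) *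
          (1 - q d k) ≤ prodMass (Function.update
            (fun e => if e ∈ D then Pi.single (x e) 1 else errWeight p) (lab d) (Pi.single a 1)) A := by
      intro a k hk
      have hE' := hE.reveal hlab hd hv a hk
      have hW : (Function.update (fun e => if e ∈ D then Pi.single (x e) 1 else errWeight p)
          (lab d) (Pi.single a 1) : ι → ZMod 2 → ℝ) =
          fun e => if e ∈ insert (lab d) D then Pi.single (Function.update x (lab d) a e) 1
            else errWeight p := by
        funext e
        by_cases he : e = lab d
        · subst he; simp
        · simp [he]
      rw [hW]
      refine le_trans ?_ (ih _ ?_ hE' rfl)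
      · rw [Finset.prod_union]
        · have h1 : ∏ d' ∈ Q.erase d, (1 - (p * q d' (Function.update h d.snd k d'.fst + 1) +
              (1 - p) * q d' (Function.update h d.snd k d'.fst - 1))) =
              ∏ d' ∈ Q.erase d, (1 - (p * q d' (h d'.fst + 1) + (1 - p) * q d' (h d'.fst - 1))) := by
            refine Finset.prod_congr rfl fun d' hd' => ?_
            have := (hE.pending d' (Finset.mem_of_mem_erase hd')).1
            rw [Function.update_of_ne (fun h' : d'.fst = d.snd => hv (h' ▸ this))]
          rw [h1]
          have h2 : 0 ≤ ∏ d' ∈ Q.erase d,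
              (1 - (p * q d' (h d'.fst + 1) + (1 - p) * q d' (h d'.fst - 1))) :=
            Finset.prod_nonneg fun d' _ => hg1 d' _
          refine sub_le_sub_left (mul_le_mul_of_nonneg_left ?_ h2) 1
          split_ifs with hk'
          · refine le_trans (le_of_eq ?_) (hq d k hk'.1 hk'.2)
            refine Finset.prod_congr rfl fun d' hd' => ?_
            rw [(Finset.mem_filter.1 hd').2.1, Function.update_self]
          · rw [hqz d k hk']; simp
        · rw [Finset.disjoint_left]
          intro d' h1 h2
          split_ifs at h2
          · have := (hE.pending d' (Finset.mem_of_mem_erase h1)).1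
            rw [(Finset.mem_filter.1 h2).2.1] at this
            exact hv this
          · simp at h2
      · rw [← hn]
        refine Finset.card_lt_card (Finset.ssubset_iff_subset_ne.2 ⟨?_, ?_⟩)
        · exact Finset.sdiff_subset_sdiff le_rfl (Finset.subset_insert _ _)
        · intro h'
          have : d.snd ∈ Finset.univ \ X := by simp [hv]
          rw [← h'] at this
          simp at this
    have h1 := hstep 1 _ rfl
    have h0 := hstep 0 _ rfl
    rw [if_neg one_ne_zero] at h1
    rw [if_pos rfl] at h0
    rw [prodMass_update _ A (lab d) p (by simp [heD]), ← Finset.mul_prod_erase Q _ hd]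
    refine le_trans (le_of_eq ?_) (add_le_add (mul_le_mul_of_nonneg_left h1 hp0)
      (mul_le_mul_of_nonneg_left h0 (sub_nonneg.2 hp1)))
    rw [← sub_eq_add_neg]
    ring

end Exploration

/-! ### A supercritical branching process with killing -/

section Supercritical

/-- A profile on the heights `0, …, H` on which the walk with up-probability `p`, killed outside,
acts almost as multiplication by `2 √(p (1 - p))`. -/
lemma exists_height_profile {p : ℝ} (hp0 : 0 < p) (hp1 : p < 1) (H : ℕ) :
    ∃ f : ℤ → ℝ, (∀ k, 0 ≤ f k) ∧ (∀ k, f k ≤ 1) ∧ (∀ k : ℤ, ¬ (0 ≤ k ∧ k ≤ H) → f k = 0) ∧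
      (∃ k : ℤ, 0 ≤ k ∧ k ≤ H ∧ f k = 1) ∧
      ∀ k : ℤ, 0 ≤ k → k ≤ H →
        2 * Real.sqrt (p * (1 - p)) * (1 - 1 / (H + 1)) * f k ≤
          p * f (k + 1) + (1 - p) * f (k - 1) := by
  have hq : 0 < 1 - p := by linarith
  set r : ℝ := Real.sqrt (1 - p) / Real.sqrt p with hr
  have hsp := Real.sqrt_pos.2 hp0
  have hsq := Real.sqrt_pos.2 hq
  have hr0 : 0 < r := div_pos hsq hsp
  have hσ : Real.sqrt (p * (1 - p)) = Real.sqrt p * Real.sqrt (1 - p) := Real.sqrt_mul hp0.le _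
  have h1 : p * r = Real.sqrt (p * (1 - p)) := by
    rw [hσ, hr]; nth_rewrite 1 [← Real.mul_self_sqrt hp0.le]; field_simp
  have h2 : (1 - p) / r = Real.sqrt (p * (1 - p)) := by
    rw [hσ, hr]; nth_rewrite 1 [← Real.mul_self_sqrt hq.le]; field_simp
  -- The factor r^k, with r = √((1-p)/p), turns the biased walk into √(p(1-p)) times the symmetric
  -- one. The parabola vanishes at -1 and H + 1, so killing costs nothing, and it has second
  -- difference -2.
  set g : ℤ → ℝ := fun k => r ^ k * ((k + 1) * (H + 1 - k)) with hg
  have hgpos : ∀ k : ℤ, 0 ≤ k → k ≤ H → 0 < g k := by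
    intro k hk0 hkH
    have h3 : (0 : ℝ) ≤ k := by exact_mod_cast hk0
    have h4 : (k : ℝ) ≤ H := by exact_mod_cast hkH
    exact mul_pos (zpow_pos hr0 _) (mul_pos (by linarith) (by linarith))
  obtain ⟨k₀, hk₀, hmax⟩ := Finset.exists_max_image (Finset.Icc (0 : ℤ) H) g ⟨0, by simp⟩
  rw [Finset.mem_Icc] at hk₀
  have hm := hgpos k₀ hk₀.1 hk₀.2
  refine ⟨fun k => if 0 ≤ k ∧ k ≤ H then g k / g k₀ else 0, ?_, ?_, ?_, ?_, ?_⟩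
  · intro k; dsimp only; split_ifs with h
    · exact (div_pos (hgpos k h.1 h.2) hm).le
    · exact le_rfl
  · intro k; dsimp only; split_ifs with h
    · exact (div_le_one hm).2 (hmax k (Finset.mem_Icc.2 h))
    · exact zero_le_one
  · intro k h; exact if_neg h
  · exact ⟨k₀, hk₀.1, hk₀.2, by simp only [if_pos hk₀, div_self hm.ne']⟩
  · intro k hk0 hkH
    have h3 : (0 : ℝ) ≤ k := by exact_mod_cast hk0
    have h4 : (k : ℝ) ≤ H := by exact_mod_cast hkH
    have hup : (if 0 ≤ k + 1 ∧ k + 1 ≤ (H : ℤ) then g (k + 1) / g k₀ else 0) = g (k + 1) / g k₀ := by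
      split_ifs with h
      · rfl
      · have : k = H := by omega
        rw [this]; simp [hg]
    have hdn : (if 0 ≤ k - 1 ∧ k - 1 ≤ (H : ℤ) then g (k - 1) / g k₀ else 0) = g (k - 1) / g k₀ := by
      split_ifs with h
      · rfl
      · have : k = 0 := by omega
        rw [this]; simp [hg]
    simp only [hup, hdn]
    rw [if_pos ⟨hk0, hkH⟩, ← mul_div_assoc, ← mul_div_assoc, ← mul_div_assoc, ← add_div]
    refine div_le_div_of_nonneg_right ?_ hm.le
    have h5 : p * g (k + 1) + (1 - p) * g (k - 1) =
        Real.sqrt (p * (1 - p)) * r ^ k * (2 * ((k + 1) * (H + 1 - k)) - 2) := by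
      simp only [hg, zpow_add_one₀ hr0.ne', zpow_sub_one₀ hr0.ne']
      push_cast
      calc _ = (p * r) * r ^ k * ((k + 1 + 1) * (H + 1 - (k + 1))) +
            ((1 - p) / r) * r ^ k * ((k - 1 + 1) * (H + 1 - (k - 1))) := by
              rw [div_eq_mul_inv]; ring
        _ = _ := by rw [h1, h2]; ring
    rw [h5]
    have h6 : (0 : ℝ) < H + 1 := by positivity
    -- On 0, ..., H the parabola is at least H + 1, so the loss of 2 is at most a proportion 2/(H+1)
    -- of it.
    have h7 : (1 : ℝ) ≤ 1 / (H + 1) * ((k + 1) * (H + 1 - k)) := by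
      rw [div_mul_eq_mul_div, le_div_iff₀ h6]; nlinarith
    have h8 : 0 ≤ Real.sqrt (p * (1 - p)) * r ^ k := by positivity
    simp only [hg]
    nlinarith [mul_le_mul_of_nonneg_left h7 h8]

/-- From 1 - g ≤ exp(-g) and exp(S) ≥ 1 + S. It bounds extinction by the mean alone, so the survival
bound does not depend on the degrees. -/
lemma prod_one_sub_le {α : Type*} (S : Finset α) (g : α → ℝ) (hg0 : ∀ i ∈ S, 0 ≤ g i)
    (hg1 : ∀ i ∈ S, g i ≤ 1) : ∏ i ∈ S, (1 - g i) ≤ 1 / (1 + ∑ i ∈ S, g i) := by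
  have h1 : ∏ i ∈ S, (1 - g i) ≤ Real.exp (-∑ i ∈ S, g i) := by
    rw [← Finset.sum_neg_distrib, Real.exp_sum]
    exact Finset.prod_le_prod (fun i hi => sub_nonneg.2 (hg1 i hi))
      fun i _ => Real.one_sub_le_exp_neg _
  refine h1.trans ?_
  have h2 := Finset.sum_nonneg hg0
  rw [Real.exp_neg, one_div]
  exact inv_anti₀ (by linarith) (by linarith [Real.add_one_le_exp (∑ i ∈ S, g i)])

variable {ι V : Type} [Fintype ι] [Fintype V] {G : SimpleGraph V}

/-- If the non-backtracking walk of growth `l` is supercritical, cycles of bounded deficiency exist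
with probability bounded below. -/
theorem le_prodMass_of_supercritical {s t : ι → V} {lab : G.Dart → ι} {H : ℕ}
    (hlab : ∀ d, s(s (lab d), t (lab d)) = d.edge) {p : ℝ} (hp0 : 0 < p) (hp1 : p < 1)
    {A : Set (ι → ZMod 2)}
    (hA : ∀ x y : ι → ZMod 2, y ≠ 0 → (∀ e ∉ Set.range lab, y e = 0) → boundary s t y = 0 →
      -((2 * H + 5 : ℕ) : ℤ) ≤ excess x y → x ∈ A)
    {w : G.Dart → ℝ} (hw0 : ∀ d, 0 < w d) {l : ℝ} (hl : 0 ≤ l)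
    (hw : ∀ d, ∑ d' ∈ succDarts d, w d' = l * w d) [Nonempty G.Dart] {a : ℝ} (ha : 1 < a)
    (hal : a ≤ l * (2 * Real.sqrt (p * (1 - p)) * (1 - 1 / (H + 1)))) :
    (a - 1) / a ≤ prodMass (fun _ => errWeight p) A := by
  obtain ⟨f, hf0, hf1, hfz, ⟨k₀, hk0, hkH, hfk⟩, hf⟩ := exists_height_profile hp0 hp1 H
  obtain ⟨d₀, hmax⟩ := Finite.exists_max w
  have hm := hw0 d₀
  have ha0 : 0 < a := by linarith
  set c : ℝ := (a - 1) / a with hc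
  have hc0 : 0 ≤ c := div_nonneg (by linarith) ha0.le
  have hc1 : c ≤ 1 := (div_le_one ha0).2 (by linarith)
  -- A product of the two eigenfunctions, scaled to have maximum c; the one-step mean then
  -- multiplies q by at least a.
  set q : G.Dart → ℤ → ℝ := fun d k => c * (w d / w d₀) * f k with hq
  have hwd0 : ∀ d, 0 ≤ w d / w d₀ := fun d => (div_pos (hw0 d) hm).le
  have hwd1 : ∀ d, w d / w d₀ ≤ 1 := fun d => (div_le_one hm).2 (hmax d)
  have hq0 : ∀ d k, 0 ≤ q d k := fun d k => mul_nonneg (mul_nonneg hc0 (hwd0 d)) (hf0 k)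
  have hqc : ∀ d k, q d k ≤ c := fun d k => by
    have := mul_le_mul (hwd1 d) (hf1 k) (hf0 k) zero_le_one
    calc q d k = c * (w d / w d₀ * f k) := by rw [hq]; ring
      _ ≤ c * 1 := mul_le_mul_of_nonneg_left (by linarith) hc0
      _ = c := mul_one c
  have hq1 : ∀ d k, q d k ≤ 1 := fun d k => (hqc d k).trans hc1
  have hbranch : ∀ d (k : ℤ), 0 ≤ k → k ≤ H →
      ∏ d' ∈ succDarts d, (1 - (p * q d' (k + 1) + (1 - p) * q d' (k - 1))) ≤ 1 - q d k := by
    intro d k hk hkH'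
    refine (prod_one_sub_le _ _ (fun d' _ => ?_) (fun d' _ => ?_)).trans ?_
    · have := hq0 d' (k + 1); have := hq0 d' (k - 1)
      have : 0 ≤ 1 - p := by linarith
      positivity
    · nlinarith [hq1 d' (k + 1), hq1 d' (k - 1)]
    · have hsum : ∑ d' ∈ succDarts d, (p * q d' (k + 1) + (1 - p) * q d' (k - 1)) =
          c * (l * w d / w d₀) * (p * f (k + 1) + (1 - p) * f (k - 1)) := by
        rw [← hw d, Finset.sum_div, Finset.mul_sum, Finset.sum_mul]
        refine Finset.sum_congr rfl fun d' _ => ?_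
        simp only [hq]; ring
      have hge : a * q d k ≤ ∑ d' ∈ succDarts d, (p * q d' (k + 1) + (1 - p) * q d' (k - 1)) := by
        rw [hsum]
        calc a * q d k ≤ l * (2 * Real.sqrt (p * (1 - p)) * (1 - 1 / (H + 1))) * q d k :=
              mul_le_mul_of_nonneg_right hal (hq0 d k)
          _ = c * (l * w d / w d₀) * (2 * Real.sqrt (p * (1 - p)) * (1 - 1 / (H + 1)) * f k) := by
              simp only [hq]; ring
          _ ≤ _ := by
              refine mul_le_mul_of_nonneg_left (hf k hk hkH') (mul_nonneg hc0 ?_)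
              rw [mul_div_assoc]; exact mul_nonneg hl (hwd0 d)
      have hy0 := hq0 d k
      have hyc : a * q d k ≤ a - 1 := by
        have := mul_le_mul_of_nonneg_left (hqc d k) ha0.le
        rwa [hc, mul_div_cancel₀ _ ha0.ne'] at this
      have hpos : 0 < 1 + a * q d k := by positivity
      calc 1 / (1 + ∑ d' ∈ succDarts d, (p * q d' (k + 1) + (1 - p) * q d' (k - 1)))
          ≤ 1 / (1 + a * q d k) := one_div_le_one_div_of_le hpos (by linarith)
        -- Here (1 + a y)(1 - y) ≥ 1 holds because a y ≤ a - 1; this dictates c = (a - 1)/a.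
        _ ≤ 1 - q d k := by
          rw [div_le_iff₀ hpos]
          nlinarith [mul_nonneg hy0 (sub_nonneg.2 hyc)]
  have hstart : IsExploration s t lab H {d₀.snd} ∅ 0 (fun _ => k₀) (succDarts d₀) := by
    refine ⟨by simp, by simp, fun v _ => ⟨by linarith, by linarith⟩, ?_, ?_⟩
    · intro u hu v hv
      rw [Finset.mem_singleton.1 hu, Finset.mem_singleton.1 hv]
      refine ⟨0, fun _ _ => rfl, by rw [map_zero, add_self_zmod_two], ?_⟩
      simp only [excess, Pi.zero_apply, ne_eq, not_true_eq_false, Finset.filter_false,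
        Finset.sum_empty]
      linarith
    · intro d hd
      refine ⟨?_, by simp, hk0, hkH⟩
      rw [(Finset.mem_filter.1 hd).2.1]; exact Finset.mem_singleton_self _
  have := hstart.survival_le hlab hp0.le hp1.le hA hq1 (fun d k hk => by simp [hq, hfz k hk])
    hbranch _ rfl
  simp only [Finset.notMem_empty, if_false] at this
  refine le_trans ?_ this
  have h1 := hbranch d₀ k₀ hk0 hkH
  have h2 : q d₀ k₀ = c := by simp only [hq, hfk, div_self hm.ne', mul_one]
  linarith

end Supercritical

/-! ### Perron eigenvalues -/

section Perron

variable {m : Type} [Fintype m]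

/-- A nonnegative matrix has a largest `r` with `r • x ≤ B *ᵥ x` for some `x` in the simplex. -/
lemma exists_max_subinvariant [Nonempty m] (B : Matrix m m ℝ) (h0 : ∀ i j, 0 ≤ B i j) :
    ∃ r : ℝ, (∃ x ∈ stdSimplex ℝ m, ∀ i, r * x i ≤ (B *ᵥ x) i) ∧
      ∀ r' : ℝ, ∀ x ∈ stdSimplex ℝ m, (∀ i, r' * x i ≤ (B *ᵥ x) i) → r' ≤ r := by
  set M : ℝ := ∑ i, ∑ j, B i j with hM
  have hB0 : ∀ x ∈ stdSimplex ℝ m, ∀ i, 0 ≤ (B *ᵥ x) i := fun x hx i =>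
    Finset.sum_nonneg fun j _ => mul_nonneg (h0 i j) (hx.1 j)
  have hbound : ∀ r' : ℝ, ∀ x ∈ stdSimplex ℝ m, (∀ i, r' * x i ≤ (B *ᵥ x) i) → r' ≤ M := by
    intro r' x hx h
    have h1 : ∑ i, r' * x i ≤ ∑ i, (B *ᵥ x) i := Finset.sum_le_sum fun i _ => h i
    rw [← Finset.mul_sum, hx.2, mul_one] at h1
    refine h1.trans (Finset.sum_le_sum fun i _ => Finset.sum_le_sum fun j _ => ?_)
    have : x j ≤ 1 := by rw [← hx.2]; exact Finset.single_le_sum (fun k _ => hx.1 k) (Finset.mem_univ j)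
    exact mul_le_of_le_one_right (h0 i j) this
  have hM0 : 0 ≤ M := Finset.sum_nonneg fun i _ => Finset.sum_nonneg fun j _ => h0 i j
  set K : Set (ℝ × (m → ℝ)) := (Set.Icc 0 M ×ˢ stdSimplex ℝ m) ∩
    {z | ∀ i, z.1 * z.2 i ≤ (B *ᵥ z.2) i} with hK
  have hKc : IsCompact K := by
    refine (isCompact_Icc.prod (isCompact_stdSimplex ℝ m)).inter_right ?_
    rw [Set.ofPred_forall]
    refine isClosed_iInter fun i => isClosed_le (by fun_prop) ?_
    simp only [Matrix.mulVec, dotProduct]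
    fun_prop
  obtain ⟨x₀, hx₀⟩ : (stdSimplex ℝ m).Nonempty := ⟨_, single_mem_stdSimplex ℝ (Classical.arbitrary m)⟩
  have hKn : K.Nonempty := ⟨(0, x₀), ⟨⟨⟨le_rfl, hM0⟩, hx₀⟩, fun i => by
    simpa using hB0 x₀ hx₀ i⟩⟩
  obtain ⟨⟨r, x⟩, ⟨⟨hr, hx⟩, hrx⟩, hmax⟩ := hKc.exists_isMaxOn hKn continuous_fst.continuousOn
  refine ⟨r, ⟨x, hx, hrx⟩, fun r' x' hx' h => ?_⟩
  by_cases hr' : 0 ≤ r'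
  · exact hmax (show (r', x') ∈ K from ⟨⟨⟨hr', hbound r' x' hx' h⟩, hx'⟩, h⟩)
  · exact (not_le.1 hr').le.trans hr.1

lemma sum_inv_smul_mem_stdSimplex {x : m → ℝ} (h0 : ∀ i, 0 ≤ x i) (hx : 0 < ∑ i, x i) :
    (∑ i, x i)⁻¹ • x ∈ stdSimplex ℝ m := by
  refine ⟨fun i => mul_nonneg (inv_nonneg.2 hx.le) (h0 i), ?_⟩
  simp only [Pi.smul_apply, smul_eq_mul, ← Finset.mul_sum]
  exact inv_mul_cancel₀ hx.ne'

/-- The Perron-Frobenius theorem for a nonnegative matrix without nontrivial forward-closed sets of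
indices whose row sums are at least `1`. -/
theorem exists_isPerronEigenvalue [DecidableEq m] [Nonempty m] (B : Matrix m m ℝ)
    (h0 : ∀ i j, 0 ≤ B i j) (hrow : ∀ i, 1 ≤ ∑ j, B i j)
    (hirr : ∀ Z : Set m, Z.Nonempty → (∀ i ∈ Z, ∀ j, 0 < B i j → j ∈ Z) → Z = Set.univ) :
    ∃ l, IsPerronEigenvalue B l := by
  obtain ⟨r, ⟨x₀, hx₀, hrx₀⟩, hmax⟩ := exists_max_subinvariant B h0
  have hmax' : ∀ r' : ℝ, ∀ x : m → ℝ, (∀ i, 0 ≤ x i) → (0 < ∑ i, x i) →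
      (∀ i, r' * x i ≤ (B *ᵥ x) i) → r' ≤ r := by
    intro r' x hx hs h
    refine hmax r' _ (sum_inv_smul_mem_stdSimplex hx hs) fun i => ?_
    rw [Matrix.mulVec_smul, Pi.smul_apply, Pi.smul_apply, smul_eq_mul, smul_eq_mul, mul_left_comm]
    exact mul_le_mul_of_nonneg_left (h i) (inv_nonneg.2 hs.le)
  have hr1 : 1 ≤ r := by
    refine hmax' 1 (fun _ => 1) (fun _ => zero_le_one) (by simp [Fintype.card_pos]) fun i => ?_
    simpa [Matrix.mulVec, dotProduct] using hrow i
  set K : Set (m → ℝ) := {x | (∀ i, 0 ≤ x i) ∧ 0 < ∑ i, x i ∧ ∀ i, r * x i ≤ (B *ᵥ x) i} with hK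
  have hx₀K : x₀ ∈ K := ⟨hx₀.1, by rw [hx₀.2]; exact one_pos, hrx₀⟩
  set T : (m → ℝ) → Finset m := fun x => Finset.univ.filter fun i => r * x i < (B *ᵥ x) i with hT
  -- Among the vectors attaining the extremal r, take one with the most strict rows; it turns out to
  -- have none.
  obtain ⟨x, hxK, hxmax⟩ : ∃ x ∈ K, ∀ x' ∈ K, (T x').card ≤ (T x).card := by
    have hfin : ((fun x => (T x).card) '' K).Finite :=
      (Set.finite_Iic (Fintype.card m)).subset (by
        rintro _ ⟨x, -, rfl⟩; exact Finset.card_le_univ _)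
    obtain ⟨_, ⟨x, hx, rfl⟩, h⟩ := Set.exists_max_image _ id hfin ⟨_, x₀, hx₀K, rfl⟩
    exact ⟨x, hx, fun x' hx' => h _ ⟨x', hx', rfl⟩⟩
  obtain ⟨hx0, hxs, hrx⟩ := hxK
  have hTempty : T x = ∅ := by
    by_contra hne
    have hne : (T x).Nonempty := Finset.nonempty_iff_ne_empty.2 hne
    set y : m → ℝ := B *ᵥ x - r • x with hy
    have hy0 : ∀ i, 0 ≤ y i := fun i => by simpa [hy] using hrx i
    have hyT : ∀ i, i ∈ T x → 0 < y i := fun i hi => by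
      simpa [hy] using (Finset.mem_filter.1 hi).2
    by_cases hall : T x = Finset.univ
    · obtain ⟨i₀, hi₀⟩ := Finite.exists_min y
      have hypos : 0 < y i₀ := hyT i₀ (hall ▸ Finset.mem_univ _)
      have := hmax' (r + y i₀ / ∑ i, x i) x hx0 hxs fun i => by
        have h1 : x i ≤ ∑ i, x i := Finset.single_le_sum (fun j _ => hx0 j) (Finset.mem_univ i)
        have h2 : y i₀ / (∑ i, x i) * x i ≤ y i₀ := by
          rw [div_mul_eq_mul_div, div_le_iff₀ hxs]
          exact mul_le_mul_of_nonneg_left h1 hypos.le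
        have h3 := hi₀ i
        have h4 : y i = (B *ᵥ x) i - r * x i := by simp [hy]
        rw [add_mul]; linarith
      have h5 : 0 < y i₀ / ∑ i, x i := div_pos hypos hxs
      linarith
    · obtain ⟨i, hiT, j, hjT, hij⟩ : ∃ i, i ∉ T x ∧ ∃ j, j ∈ T x ∧ 0 < B i j := by
        by_contra! hcl
        have hZ : {i | i ∉ T x}.Nonempty := by
          by_contra hemp
          rw [Set.not_nonempty_iff_eq_empty, Set.eq_empty_iff_forall_notMem] at hemp
          exact hall (Finset.eq_univ_iff_forall.2 fun i => by simpa using hemp i)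
        have := hirr _ hZ fun i hi j hj => fun hjT => absurd hj (not_lt.2 (hcl i hi j hjT))
        obtain ⟨j, hj⟩ := hne
        exact (this.symm ▸ Set.mem_univ j : j ∈ {i | i ∉ T x}) hj
      have hBy : ∀ k, 0 ≤ (B *ᵥ y) k := fun k =>
        Finset.sum_nonneg fun j _ => mul_nonneg (h0 k j) (hy0 j)
      have hr0 : 0 < r := by linarith
      -- This is (B + r) x, whose defect is (B + r) y: the summand r keeps strict rows strict, and B
      -- makes row i strict as well.
      set x' : m → ℝ := (2 * r) • x + y with hx'
      have hx'eq : ∀ k, (B *ᵥ x') k - r * x' k = r * y k + (B *ᵥ y) k := fun k => by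
        rw [hx', Matrix.mulVec_add, Matrix.mulVec_smul, Pi.add_apply, Pi.add_apply, Pi.smul_apply,
          Pi.smul_apply, smul_eq_mul, smul_eq_mul]
        have h4 : y k = (B *ᵥ x) k - r * x k := by simp [hy]
        rw [h4]; ring
      have hx'K : x' ∈ K := by
        refine ⟨fun k => ?_, ?_, fun k => ?_⟩
        · simp only [hx', Pi.add_apply, Pi.smul_apply, smul_eq_mul]
          have := hx0 k; have := hy0 k; positivity
        · simp only [hx', Pi.add_apply, Pi.smul_apply, smul_eq_mul, Finset.sum_add_distrib,
            ← Finset.mul_sum]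
          have := Finset.sum_nonneg fun k (_ : k ∈ Finset.univ) => hy0 k
          positivity
        · have := hx'eq k; have := hBy k; have := mul_nonneg hr0.le (hy0 k); linarith
      have hsub : insert i (T x) ⊆ T x' := by
        intro k hk
        refine Finset.mem_filter.2 ⟨Finset.mem_univ _, ?_⟩
        rcases Finset.mem_insert.1 hk with rfl | hk
        · have h5 : 0 < (B *ᵥ y) k := by
            refine lt_of_lt_of_le (mul_pos hij (hyT j hjT)) ?_
            exact Finset.single_le_sum (f := fun j => B k j * y j)
              (fun j _ => mul_nonneg (h0 k j) (hy0 j)) (Finset.mem_univ j)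
          have := hx'eq k; have := mul_nonneg hr0.le (hy0 k); linarith
        · have := hx'eq k; have := hBy k; have := mul_pos hr0 (hyT k hk); linarith
      have h6 := (Finset.card_le_card hsub).trans (hxmax x' hx'K)
      rw [Finset.card_insert_of_notMem hiT] at h6
      omega
  have heig : ∀ i, (B *ᵥ x) i = r * x i := fun i => by
    refine le_antisymm (not_lt.1 fun h => ?_) (hrx i)
    have : i ∈ T x := Finset.mem_filter.2 ⟨Finset.mem_univ _, h⟩
    simp [hTempty] at this
  refine ⟨r, by linarith, ⟨x, fun i => lt_of_le_of_ne (hx0 i) fun hi => ?_, funext heig⟩, ?_⟩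
  -- The zero set of the eigenvector is forward closed, so it is empty or everything.
  · have := hirr {i | x i = 0} ⟨i, hi.symm⟩ fun i hi j hij => by
      have h1 : ∑ j, B i j * x j = 0 := by
        have := heig i
        rw [show x i = 0 from hi, mul_zero] at this
        exact this
      rw [Finset.sum_eq_zero_iff_of_nonneg fun j _ => mul_nonneg (h0 i j) (hx0 j)] at h1
      exact (mul_eq_zero.1 (h1 j (Finset.mem_univ j))).resolve_left hij.ne'
    refine absurd hxs (not_lt.2 (Finset.sum_nonpos fun j _ => ?_))
    exact le_of_eq (this.symm ▸ Set.mem_univ j : j ∈ {i | x i = 0})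
  · intro z hz
    obtain ⟨v, hv⟩ := hz.exists_hasEigenvector
    have hv1 := hv.apply_eq_smul
    rw [Matrix.toLin'_apply] at hv1
    -- By the triangle inequality, the moduli of a complex eigenvector form a vector subinvariant
    -- for ‖z‖.
    refine hmax' ‖z‖ (fun i => ‖v i‖) (fun i => norm_nonneg _) ?_ fun i => ?_
    · obtain ⟨i, hi⟩ := Function.ne_iff.1 hv.2
      exact Finset.sum_pos' (fun i _ => norm_nonneg _) ⟨i, Finset.mem_univ _, norm_pos_iff.2 hi⟩
    · have h1 := congrFun hv1 i
      rw [Pi.smul_apply, smul_eq_mul] at h1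
      rw [← norm_mul, ← h1]
      simp only [Matrix.mulVec, dotProduct, Matrix.map_apply]
      refine (norm_sum_le _ _).trans (le_of_eq (Finset.sum_congr rfl fun j _ => ?_))
      rw [norm_mul, Complex.norm_real, Real.norm_of_nonneg (h0 i j)]

end Perron

/-! ### Non-backtracking matrices of connected graphs -/

section NonBacktracking

variable {V : Type} [Fintype V] {G : SimpleGraph V}

lemma forall_of_connected {V : Type*} {G : SimpleGraph V} (hG : G.Connected)
    {P : V → Prop} (hP : ∀ u v, G.Adj u v → P u → P v) {u : V} (hu : P u) (v : V) : P v := by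
  obtain ⟨w⟩ := hG.preconnected u v
  induction w with
  | nil => exact hu
  | cons h _ ih => exact ih (hP _ _ h hu)

lemma card_darts_fst (v : V) :
    (Finset.univ.filter fun d : G.Dart => d.fst = v).card = G.degree v :=
  G.dart_fst_fiber_card_eq_degree v

lemma card_darts_snd (v : V) :
    (Finset.univ.filter fun d : G.Dart => d.snd = v).card = G.degree v := by
  rw [← card_darts_fst]
  refine Finset.card_bij (fun d _ => d.symm) ?_ ?_ ?_
  · intro d hd; simpa using hd
  · intro d _ d' _ h; exact SimpleGraph.Dart.symm_involutive.injective h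
  · intro d hd; exact ⟨d.symm, by simpa using hd, SimpleGraph.Dart.symm_symm d⟩

lemma mem_succDarts (d d' : G.Dart) : d' ∈ succDarts d ↔ d'.fst = d.snd ∧ d'.snd ≠ d.fst := by
  simp [succDarts]

lemma card_succDarts (d : G.Dart) : (succDarts d).card + 1 = G.degree d.snd := by
  rw [← card_darts_fst, ← Finset.card_erase_add_one
    (show d.symm ∈ Finset.univ.filter fun d' : G.Dart => d'.fst = d.snd by simp)]
  congr 2
  ext d'
  simp only [succDarts, Finset.mem_filter, Finset.mem_univ, true_and, Finset.mem_erase]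
  rw [and_comm]
  refine and_congr_left fun h => not_congr ⟨fun h' => ?_, fun h' => by rw [h']; rfl⟩
  exact SimpleGraph.Dart.ext _ _ (Prod.ext h h')

lemma sum_nonBacktrackingMatrix_mul (d : G.Dart) (w : G.Dart → ℝ) :
    ∑ d', nonBacktrackingMatrix G d d' * w d' = ∑ d' ∈ succDarts d, w d' := by
  rw [succDarts, Finset.sum_filter]
  refine Finset.sum_congr rfl fun d' _ => ?_
  simp only [nonBacktrackingMatrix, Matrix.of_apply, ite_mul, one_mul, zero_mul]
  exact if_congr (and_congr Iff.rfl ne_comm) rfl rfl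

lemma nonBacktrackingMatrix_row_sum (d : G.Dart) :
    ∑ d', nonBacktrackingMatrix G d d' = (G.degree d.snd : ℝ) - 1 := by
  have := sum_nonBacktrackingMatrix_mul d fun _ => 1
  simp only [mul_one, Finset.sum_const, nsmul_eq_mul] at this
  rw [this, ← card_succDarts]; simp

/-- In a connected graph of minimum degree at least two that is not a cycle, every dart is reached
from any given dart by a non-backtracking walk. -/
lemma forward_closed_eq_univ (hG : G.Connected) (hdeg : ∀ v, 2 ≤ G.degree v)
    (hne : ∃ v, G.degree v ≠ 2) {Z : Set G.Dart} (hZ : Z.Nonempty)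
    (hcl : ∀ d ∈ Z, ∀ d' ∈ succDarts d, d' ∈ Z) : Z = Set.univ := by
  set I : V → Finset G.Dart := fun v => Finset.univ.filter fun d => d ∈ Z ∧ d.snd = v with hI
  set O : V → Finset G.Dart := fun v => Finset.univ.filter fun d => d ∈ Z ∧ d.fst = v with hO
  have memI : ∀ d v, d ∈ I v ↔ d ∈ Z ∧ d.snd = v := by simp [hI]
  have memO : ∀ d v, d ∈ O v ↔ d ∈ Z ∧ d.fst = v := by simp [hO]
  have hIle : ∀ v, (I v).card ≤ G.degree v := fun v => by
    rw [← card_darts_snd]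
    exact Finset.card_le_card fun d hd => by simpa using ((memI d v).1 hd).2
  have hOle : ∀ v, (O v).card ≤ G.degree v := fun v => by
    rw [← card_darts_fst]
    exact Finset.card_le_card fun d hd => by simpa using ((memO d v).1 hd).2
  have hone : ∀ d ∈ Z, G.degree d.snd ≤ (O d.snd).card + 1 := fun d hd => by
    rw [← card_succDarts]
    refine Nat.succ_le_succ (Finset.card_le_card fun d' hd' => (memO _ _).2 ⟨hcl d hd d' hd', ?_⟩)
    exact ((mem_succDarts _ _).1 hd').1
  have htwo : ∀ v, 2 ≤ (I v).card → (O v).card = G.degree v := by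
    intro v hv
    refine le_antisymm (hOle v) ?_
    obtain ⟨d₁, h₁, d₂, h₂, h12⟩ := Finset.one_lt_card.1 hv
    rw [memI] at h₁ h₂
    rw [← card_darts_fst]
    refine Finset.card_le_card fun d hd => (memO _ _).2 ⟨?_, by simpa using hd⟩
    have hd : d.fst = v := by simpa using hd
    by_cases h : d.snd = d₁.fst
    · refine hcl d₂ h₂.1 d ((mem_succDarts _ _).2 ⟨by rw [hd, h₂.2], fun h' => h12 ?_⟩)
      exact SimpleGraph.Dart.ext _ _ (Prod.ext (by rw [← h, h']) (h₁.2.trans h₂.2.symm))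
    · exact hcl d₁ h₁.1 d ((mem_succDarts _ _).2 ⟨by rw [hd, h₁.2], h⟩)
  -- One entering dart of `Z` forces all but one of the leaving darts into `Z`, and two force all of
  -- them. Both counts sum to |Z|, so they agree at every vertex.
  have hIleO : ∀ v, (I v).card ≤ (O v).card := by
    intro v
    rcases Nat.lt_or_ge (I v).card 2 with h | h
    · rcases (I v).eq_empty_or_nonempty with h0 | ⟨d, hd⟩
      · simp [h0]
      · have h1 := (memI _ _).1 hd
        have := hone d h1.1
        rw [h1.2] at this
        have := hdeg v
        omega
    · rw [htwo v h]; exact hIle v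
  have hsum : ∑ v, (I v).card = ∑ v, (O v).card := by
    have h1 : ∀ f : G.Dart → V, ∑ v, (Finset.univ.filter fun d => d ∈ Z ∧ f d = v).card =
        (Finset.univ.filter fun d => d ∈ Z).card := fun f => by
      rw [Finset.card_eq_sum_card_fiberwise (f := f) (t := Finset.univ) (by simp)]
      simp only [Finset.filter_filter]
    exact (h1 fun d => d.snd).trans (h1 fun d => d.fst).symm
  have heq : ∀ v, (I v).card = (O v).card := fun v =>
    (Finset.sum_eq_sum_iff_of_le fun v _ => hIleO v).1 hsum v (Finset.mem_univ v)
  by_cases hfull : ∃ v, 2 ≤ (I v).card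
  · obtain ⟨v₀, hv₀⟩ := hfull
    have hOall : ∀ v, 2 ≤ (I v).card → ∀ d : G.Dart, d.fst = v → d ∈ Z := by
      intro v hv d hd
      have h1 : O v = Finset.univ.filter fun d : G.Dart => d.fst = v := by
        refine Finset.eq_of_subset_of_card_le (fun d hd => by simpa using ((memO d v).1 hd).2) ?_
        rw [card_darts_fst, htwo v hv]
      have : d ∈ O v := by rw [h1]; simpa using hd
      exact ((memO _ _).1 this).1
    have hIall : ∀ v, 2 ≤ (I v).card → ∀ d : G.Dart, d.snd = v → d ∈ Z := by
      intro v hv d hd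
      have h1 : I v = Finset.univ.filter fun d : G.Dart => d.snd = v := by
        refine Finset.eq_of_subset_of_card_le (fun d hd => by simpa using ((memI d v).1 hd).2) ?_
        rw [card_darts_snd, heq, htwo v hv]
      have : d ∈ I v := by rw [h1]; simpa using hd
      exact ((memI _ _).1 this).1
    -- If all darts at v lie in `Z`, so do both darts of the edge vu; together they force every dart
    -- leaving u into `Z`.
    have hall := forall_of_connected hG (P := fun v => 2 ≤ (I v).card) (by
      intro v u hvu hv
      by_contra hu
      set d : G.Dart := ⟨(v, u), hvu⟩ with hd
      have hdZ : d ∈ Z := hOall v hv d rfl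
      have hdsZ : d.symm ∈ Z := hIall v hv d.symm rfl
      have h1 : insert d.symm (succDarts d) ⊆ O u := by
        intro d' hd'
        rcases Finset.mem_insert.1 hd' with rfl | hd'
        · exact (memO _ _).2 ⟨hdsZ, rfl⟩
        · exact (memO _ _).2 ⟨hcl d hdZ d' hd', ((mem_succDarts _ _).1 hd').1⟩
      have h2 := Finset.card_le_card h1
      rw [Finset.card_insert_of_notMem (fun h => ((mem_succDarts _ _).1 h).2 rfl), card_succDarts] at h2
      have h3 : 2 ≤ (O u).card := (hdeg u).trans h2
      rw [← heq] at h3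
      exact hu h3) hv₀
    exact Set.eq_univ_of_forall fun d => hOall d.fst (hall d.fst) d rfl
  · push Not at hfull
    exfalso
    obtain ⟨d₀, hd₀⟩ := hZ
    -- With at most one entering dart everywhere, every vertex is still reached, and each then has
    -- degree exactly 2.
    have hall := forall_of_connected hG (P := fun v => 0 < (I v).card) (by
      intro v u hvu hv
      obtain ⟨d, hd⟩ := Finset.card_pos.1 hv
      obtain ⟨hdZ, rfl⟩ := (memI _ _).1 hd
      by_cases hu : u = d.fst
      · rw [heq]
        exact Finset.card_pos.2 ⟨d, (memO _ _).2 ⟨hdZ, hu.symm⟩⟩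
      · exact Finset.card_pos.2 ⟨⟨(d.snd, u), hvu⟩, (memI _ _).2
          ⟨hcl d hdZ _ ((mem_succDarts _ _).2 ⟨rfl, hu⟩), rfl⟩⟩) (u := d₀.snd)
      (Finset.card_pos.2 ⟨d₀, (memI _ _).2 ⟨hd₀, rfl⟩⟩)
    obtain ⟨v, hv⟩ := hne
    obtain ⟨d, hd⟩ := Finset.card_pos.1 (hall v)
    obtain ⟨hdZ, rfl⟩ := (memI _ _).1 hd
    have h1 := hone d hdZ
    have h2 := heq d.snd
    have h3 := hfull d.snd
    have h4 := hdeg d.snd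
    omega

lemma nonempty_dart_of_degree [Nonempty V] (hdeg : ∀ v, 2 ≤ G.degree v) : Nonempty G.Dart := by
  have h := hdeg (Classical.arbitrary V)
  rw [← card_darts_fst] at h
  obtain ⟨d, -⟩ := Finset.card_pos.1 (lt_of_lt_of_le two_pos h)
  exact ⟨d⟩

theorem exists_isPerronEigenvalue_nonBacktrackingMatrix [DecidableEq V] (hG : G.Connected)
    (hdeg : ∀ v, 2 ≤ G.degree v) (hne : ∃ v, G.degree v ≠ 2) :
    ∃ l, IsPerronEigenvalue (nonBacktrackingMatrix G) l := by
  have := hG.nonempty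
  have := nonempty_dart_of_degree hdeg
  refine exists_isPerronEigenvalue _ (fun d d' => ?_) (fun d => ?_) fun Z hZ hcl => ?_
  · simp only [nonBacktrackingMatrix, Matrix.of_apply]; split_ifs <;> norm_num
  · rw [nonBacktrackingMatrix_row_sum]
    have : (2 : ℝ) ≤ G.degree d.snd := by exact_mod_cast hdeg d.snd
    linarith
  · refine forward_closed_eq_univ hG hdeg hne hZ fun d hd d' hd' => hcl d hd d' ?_
    have := (mem_succDarts d d').1 hd'
    simp only [nonBacktrackingMatrix, Matrix.of_apply]
    rw [if_pos ⟨this.1, this.2.symm⟩]; exact one_pos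

lemma IsPerronEigenvalue.sum_succDarts [DecidableEq V] {l : ℝ}
    (hl : IsPerronEigenvalue (nonBacktrackingMatrix G) l) :
    ∃ w : G.Dart → ℝ, (∀ d, 0 < w d) ∧ ∀ d, ∑ d' ∈ succDarts d, w d' = l * w d := by
  obtain ⟨w, hw, hBw⟩ := hl.exists_eigenvector
  refine ⟨w, hw, fun d => ?_⟩
  rw [← sum_nonBacktrackingMatrix_mul]
  exact congrFun hBw d

/-- Evaluate the eigenvector equation at a dart of least weight: every dart has a successor. -/
lemma IsPerronEigenvalue.one_le [DecidableEq V] [Nonempty V] {l : ℝ} (hdeg : ∀ v, 2 ≤ G.degree v)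
    (hl : IsPerronEigenvalue (nonBacktrackingMatrix G) l) : 1 ≤ l := by
  have := nonempty_dart_of_degree hdeg
  obtain ⟨w, hw, hs⟩ := hl.sum_succDarts
  obtain ⟨d, hd⟩ := Finite.exists_min w
  have h1 : (1 : ℝ) * w d ≤ l * w d := by
    rw [← hs d]
    refine le_trans ?_ (Finset.card_nsmul_le_sum _ _ _ fun d' _ => hd d')
    rw [nsmul_eq_mul]
    refine mul_le_mul_of_nonneg_right ?_ (hw d).le
    have := card_succDarts d
    have := hdeg d.snd
    exact_mod_cast (by omega : 1 ≤ (succDarts d).card)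
  exact le_of_mul_le_mul_right h1 (hw d)

lemma IsPerronEigenvalue.le_of_degree_le [DecidableEq V] [Nonempty V] {l : ℝ} (hdeg : ∀ v, 2 ≤ G.degree v) {Δ : ℕ}
    (hΔ : ∀ v, G.degree v ≤ Δ) (hl : IsPerronEigenvalue (nonBacktrackingMatrix G) l) : l ≤ Δ := by
  have := nonempty_dart_of_degree hdeg
  obtain ⟨w, hw, hs⟩ := hl.sum_succDarts
  obtain ⟨d, hd⟩ := Finite.exists_max w
  have h1 : l * w d ≤ Δ * w d := by
    rw [← hs d]
    refine le_trans (Finset.sum_le_card_nsmul _ _ _ fun d' _ => hd d') ?_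
    rw [nsmul_eq_mul]
    refine mul_le_mul_of_nonneg_right ?_ (hw d).le
    have := card_succDarts d
    have := hΔ d.snd
    exact_mod_cast (by omega : (succDarts d).card ≤ Δ)
  exact le_of_mul_le_mul_right h1 (hw d)

end NonBacktracking

/-! ### The limit inferior of the Perron eigenvalues -/

section LambdaStar

/-- The graph on `Fin n` in which numbers at distance at most `k` are adjacent. -/
def bandGraph (n k : ℕ) : SimpleGraph (Fin n) where
  Adj i j := i ≠ j ∧ (i : ℕ) ≤ j + k ∧ (j : ℕ) ≤ i + k
  symm := ⟨fun _ _ h => ⟨h.1.symm, h.2.2, h.2.1⟩⟩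
  loopless := ⟨fun _ h => h.1 rfl⟩

lemma bandGraph_connected {n k : ℕ} (hn : 0 < n) (hk : 0 < k) : (bandGraph n k).Connected := by
  rw [SimpleGraph.connected_iff_exists_forall_reachable]
  refine ⟨⟨0, hn⟩, ?_⟩
  rintro ⟨i, hi⟩
  induction i with
  | zero => exact SimpleGraph.Reachable.refl _
  | succ i ih =>
    refine (ih (by omega)).trans (SimpleGraph.Adj.reachable ⟨?_, ?_, ?_⟩)
    · intro h; have := congrArg Fin.val h; simp at this
    · simp; omega
    · simp; omega

lemma le_degree_bandGraph {n k : ℕ} (hn : 2 * k + 1 ≤ n) (i : Fin n) :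
    k ≤ (bandGraph n k).degree i := by
  rw [← SimpleGraph.card_neighborFinset_eq_degree]
  -- As n ≥ 2k + 1, there are k places to the right of i or k to the left.
  by_cases hi : (i : ℕ) + k < n
  · rw [← Finset.card_range k]
    refine Finset.card_le_card_of_injOn (fun j => if h : (i : ℕ) + j + 1 < n then ⟨i + j + 1, h⟩ else i)
      ?_ ?_
    · intro j hj
      have hj : j < k := by simpa using hj
      simp only [Finset.mem_coe, SimpleGraph.mem_neighborFinset]
      rw [dif_pos (by omega)]
      refine ⟨?_, ?_, ?_⟩
      · intro h; have := congrArg Fin.val h; simp at this; omega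
      · simp; omega
      · simp; omega
    · intro j hj j' hj' h
      have hj : j < k := by simpa using hj
      have hj' : j' < k := by simpa using hj'
      simp only at h
      rw [dif_pos (by omega), dif_pos (by omega)] at h
      have := congrArg Fin.val h; simp at this; omega
  · rw [← Finset.card_range k]
    refine Finset.card_le_card_of_injOn (fun j => ⟨i - (j + 1), by omega⟩) ?_ ?_
    · intro j hj
      have hj : j < k := by simpa using hj
      simp only [Finset.mem_coe, SimpleGraph.mem_neighborFinset]
      refine ⟨?_, ?_, ?_⟩
      · intro h; have := congrArg Fin.val h; simp at this; omega
      · simp; omega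
      · simp; omega
    · intro j hj j' hj' h
      have hj : j < k := by simpa using hj
      have hj' : j' < k := by simpa using hj'
      have := congrArg Fin.val h; simp at this; omega

lemma degree_bandGraph_le {n k : ℕ} (i : Fin n) : (bandGraph n k).degree i ≤ 2 * k + 1 := by
  rw [← SimpleGraph.card_neighborFinset_eq_degree, ← Finset.card_range (2 * k + 1)]
  refine Finset.card_le_card_of_injOn (fun j => (j : ℕ) + k - i) ?_ ?_
  · intro j hj
    have hj : (bandGraph n k).Adj i j := by simpa using hj
    obtain ⟨-, h1, h2⟩ := hj
    simp only [Finset.coe_range, Set.mem_Iio]; omega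
  · intro j hj j' hj' h
    have hj : (bandGraph n k).Adj i j := by simpa using hj
    have hj' : (bandGraph n k).Adj i j' := by simpa using hj'
    obtain ⟨-, h1, h2⟩ := hj
    obtain ⟨-, h3, h4⟩ := hj'
    simp only at h
    ext; omega

lemma one_le_of_mem_denseGraphs {μ : ℝ} {n : ℕ} {G : SimpleGraph (Fin n)} (hG : G ∈ denseGraphs μ n)
    {l : ℝ} (hl : IsPerronEigenvalue (nonBacktrackingMatrix G) l) : 1 ≤ l := by
  have := hG.1.nonempty
  exact hl.one_le hG.2.2

lemma lambdaStarAt_le {μ : ℝ} {n : ℕ} {G : SimpleGraph (Fin n)} (hG : G ∈ denseGraphs μ n)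
    {l : ℝ} (hl : IsPerronEigenvalue (nonBacktrackingMatrix G) l) : lambdaStarAt μ n ≤ l := by
  refine csInf_le ⟨1, ?_⟩ ⟨G, hG, hl⟩
  rintro _ ⟨G', hG', hl'⟩
  exact one_le_of_mem_denseGraphs hG' hl'

/-- Ensures that neither an infimum over the empty set nor an unbounded sequence distorts the limit
inferior. Band graphs of width k ≥ 3 are dense enough, are not cycles, and have degrees bounded
independently of n. -/
lemma exists_lambdaStarAt_mem_Icc (μ : ℝ) :
    ∃ b : ℝ, ∀ᶠ n in Filter.atTop, lambdaStarAt μ n ∈ Set.Icc 1 b := by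
  set k : ℕ := max 3 ⌈μ⌉₊ with hk
  refine ⟨(2 * k + 1 : ℕ), Filter.eventually_atTop.2 ⟨2 * k + 1, fun n hn => ?_⟩⟩
  have hk3 : 3 ≤ k := le_max_left _ _
  have hn0 : 0 < n := by omega
  have : Nonempty (Fin n) := ⟨⟨0, hn0⟩⟩
  have hconn := bandGraph_connected hn0 (by omega : 0 < k)
  have hdeg : ∀ v, 2 ≤ (bandGraph n k).degree v := fun v => by
    have := le_degree_bandGraph hn v; omega
  have hG : bandGraph n k ∈ denseGraphs μ n := by
    refine ⟨hconn, ?_, hdeg⟩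
    have hn0' : (0 : ℝ) < n := by exact_mod_cast hn0
    rw [le_div_iff₀ hn0']
    have h1 : ∀ v ∈ (Finset.univ : Finset (Fin n)), μ ≤ ((bandGraph n k).degree v : ℝ) := fun v _ => by
      have h2 : μ ≤ k := (Nat.le_ceil μ).trans (by exact_mod_cast le_max_right _ _)
      have h3 : (k : ℝ) ≤ (bandGraph n k).degree v := by exact_mod_cast le_degree_bandGraph hn v
      linarith
    have := Finset.card_nsmul_le_sum _ _ _ h1
    simpa [mul_comm] using this
  obtain ⟨l, hl⟩ := exists_isPerronEigenvalue_nonBacktrackingMatrix hconn hdeg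
    ⟨⟨0, hn0⟩, by have := le_degree_bandGraph hn ⟨0, hn0⟩; omega⟩
  constructor
  · refine le_csInf ⟨l, _, hG, hl⟩ ?_
    rintro _ ⟨G', hG', hl'⟩
    exact one_le_of_mem_denseGraphs hG' hl'
  · exact (lambdaStarAt_le hG hl).trans (hl.le_of_degree_le hdeg degree_bandGraph_le)

lemma one_le_lambdaStar (μ : ℝ) : 1 ≤ lambdaStar μ := by
  obtain ⟨b, hb⟩ := exists_lambdaStarAt_mem_Icc μ
  refine Filter.le_liminf_of_le (Filter.IsBoundedUnder.isCoboundedUnder_ge ?_) (hb.mono fun n h => h.1)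
  exact ⟨b, Filter.eventually_map.2 (hb.mono fun n h => h.2)⟩

lemma eventually_lt_lambdaStarAt {μ b : ℝ} (h : b < lambdaStar μ) :
    ∀ᶠ n in Filter.atTop, b < lambdaStarAt μ n := by
  obtain ⟨c, hc⟩ := exists_lambdaStarAt_mem_Icc μ
  exact Filter.eventually_lt_of_lt_liminf h ⟨1, Filter.eventually_map.2 (hc.mono fun n h => h.1)⟩

end LambdaStar

/-! ### Dense graphs from edge systems -/

section EdgeSystem

variable {ι V : Type}

lemma exists_other_end {s t : ι → V} {e : ι} {a : V}
    (h : ((if s e = a then 1 else 0) + (if t e = a then 1 else 0) : ZMod 2) ≠ 0) :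
    ∃ b, s(s e, t e) = s(a, b) := by
  by_cases h1 : s e = a
  · exact ⟨t e, by rw [h1]⟩
  · by_cases h2 : t e = a
    · exact ⟨s e, by rw [h2, Sym2.eq_swap]⟩
    · simp [h1, h2] at h

/-- A set `E` of edges, without loops or parallel edges, connected in the sense of cuts, and covered
by even subsets, is the edge set of a connected graph of minimum degree at least two. -/
lemma exists_connected_graph [Fintype ι] [Fintype V] [Nontrivial V] {s t : ι → V} {E : Finset ι}
    (hcut : ∀ A : Set V, (∀ e ∈ E, s e ∈ A ↔ t e ∈ A) → A = ∅ ∨ A = Set.univ)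
    (hloop : ∀ e ∈ E, s e ≠ t e)
    (hpar : ∀ e ∈ E, ∀ e' ∈ E, s(s e, t e) = s(s e', t e') → e = e')
    (heven : ∀ e ∈ E, ∃ y : ι → ZMod 2, (∀ e' ∉ E, y e' = 0) ∧ boundary s t y = 0 ∧ y e ≠ 0) :
    ∃ G : SimpleGraph V, G.Connected ∧ (∀ v, 2 ≤ G.degree v) ∧ 2 * E.card ≤ ∑ v, G.degree v ∧
      ∃ lab : G.Dart → ι, (∀ d, lab d ∈ E) ∧ ∀ d, s(s (lab d), t (lab d)) = d.edge := by
  obtain ⟨G, hadj⟩ : ∃ G : SimpleGraph V, ∀ a b, G.Adj a b ↔ ∃ e ∈ E, s(s e, t e) = s(a, b) :=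
    ⟨{ Adj := fun a b => ∃ e ∈ E, s(s e, t e) = s(a, b)
       symm := ⟨fun a b ⟨e, he, h⟩ => ⟨e, he, h.trans Sym2.eq_swap⟩⟩
       loopless := ⟨fun a ⟨e, he, h⟩ => hloop e he (by
        rcases Sym2.eq_iff.1 h with ⟨h1, h2⟩ | ⟨h1, h2⟩ <;> rw [h1, h2])⟩ }, fun _ _ => Iff.rfl⟩
  have hconn : G.Connected := by
    rw [SimpleGraph.connected_iff_exists_forall_reachable]
    let v₀ : V := Classical.arbitrary V
    refine ⟨v₀, ?_⟩
    rcases hcut {v | G.Reachable v₀ v} (fun e he => by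
      have : G.Adj (s e) (t e) := (hadj _ _).2 ⟨e, he, rfl⟩
      exact ⟨fun h => SimpleGraph.Reachable.trans h this.reachable,
        fun h => SimpleGraph.Reachable.trans h this.symm.reachable⟩) with h | h
    · have h1 : v₀ ∈ {v | G.Reachable v₀ v} := SimpleGraph.Reachable.refl _
      simp [h] at h1
    · exact fun v => (h.symm ▸ Set.mem_univ v : v ∈ {v | G.Reachable v₀ v})
  have hdeg : ∀ v, 2 ≤ G.degree v := by
    intro a
    -- Otherwise {a} would be a cut crossed by no edge.
    obtain ⟨e, he, hea⟩ : ∃ e ∈ E,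
        ((if s e = a then 1 else 0) + (if t e = a then 1 else 0) : ZMod 2) ≠ 0 := by
      by_contra! hcon
      rcases hcut {a} (fun e he => by
        have h1 := hcon e he
        have h2 := hloop e he
        simp only [Set.mem_singleton_iff]
        by_cases h3 : s e = a <;> by_cases h4 : t e = a <;> simp_all) with h | h
      · simp at h
      · obtain ⟨b, hb⟩ := exists_ne a
        exact hb (h.symm ▸ Set.mem_univ b : b ∈ ({a} : Set V))
    obtain ⟨y, hyE, hyb, hye⟩ := heven e he
    have hsum := congrFun hyb a
    rw [boundary_apply, Pi.zero_apply] at hsum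
    -- By parity an even set through e has a second edge at a, and it leads to another neighbour
    -- since there are no parallel edges.
    obtain ⟨e', hne, hy'⟩ : ∃ e', e' ≠ e ∧
        y e' * ((if s e' = a then 1 else 0) + (if t e' = a then 1 else 0)) ≠ 0 := by
      by_contra! hcon
      rw [Finset.sum_eq_single e (fun e' _ h => hcon e' h) (by simp)] at hsum
      exact (mul_ne_zero hye hea) hsum
    have he' : e' ∈ E := by
      by_contra h; exact (left_ne_zero_of_mul hy') (hyE e' h)
    obtain ⟨b, hb⟩ := exists_other_end hea
    obtain ⟨b', hb'⟩ := exists_other_end (right_ne_zero_of_mul hy')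
    have hbb : b ≠ b' := by
      rintro rfl
      exact hne (hpar e' he' e he (hb'.trans hb.symm))
    rw [← SimpleGraph.card_neighborFinset_eq_degree, ← Finset.card_pair hbb]
    refine Finset.card_le_card fun c hc => ?_
    rw [SimpleGraph.mem_neighborFinset, hadj]
    rcases Finset.mem_insert.1 hc with rfl | hc
    · exact ⟨e, he, hb⟩
    · rw [Finset.mem_singleton.1 hc]; exact ⟨e', he', hb'⟩
  have hcard : E.card ≤ G.edgeFinset.card := by
    refine Finset.card_le_card_of_injOn (fun e => s(s e, t e)) (fun e he => ?_)
      fun e he e' he' h => hpar e he e' he' h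
    rw [Finset.mem_coe, SimpleGraph.mem_edgeFinset, SimpleGraph.mem_edgeSet]
    exact (hadj _ _).2 ⟨e, he, rfl⟩
  have hlab : ∀ d : G.Dart, ∃ e ∈ E, s(s e, t e) = d.edge := fun d => (hadj _ _).1 d.adj
  choose lab hlabE hlab using hlab
  refine ⟨G, hconn, hdeg, ?_, lab, hlabE, hlab⟩
  rw [G.sum_degrees_eq_twice_card_edges]
  exact Nat.mul_le_mul_left 2 hcard

end EdgeSystem

/-! ### Minimal subsets of high rate -/

section Minimal

variable {ι V : Type} [Fintype ι] (s t : ι → V)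

/-- The words of zero boundary supported in `S`. -/
def evenCode (S : Finset ι) : Submodule (ZMod 2) (ι → ZMod 2) where
  carrier := {x | boundary s t x = 0 ∧ ∀ e ∉ S, x e = 0}
  zero_mem' := ⟨map_zero _, fun _ _ => rfl⟩
  add_mem' := fun hx hy => ⟨by rw [map_add, hx.1, hy.1, add_zero],
    fun e he => by rw [Pi.add_apply, hx.2 e he, hy.2 e he, add_zero]⟩
  smul_mem' := fun a x hx => ⟨by rw [map_smul, hx.1, smul_zero],
    fun e he => by rw [Pi.smul_apply, hx.2 e he, smul_zero]⟩

/-- `S` is a nonempty set of coordinates of rate at least `R`, and of minimal size. -/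
structure IsRateMinimal (R : ℝ) (S : Finset ι) : Prop where
  nonempty : S.Nonempty
  le : R * S.card ≤ Module.finrank (ZMod 2) (evenCode s t S)
  lt : ∀ S' : Finset ι, S'.Nonempty → S' ⊂ S →
    (Module.finrank (ZMod 2) (evenCode s t S') : ℝ) < R * S'.card

variable {s t}

lemma exists_isRateMinimal {R : ℝ} [Nonempty ι]
    (h : R * Fintype.card ι ≤ Module.finrank (ZMod 2) (evenCode s t Finset.univ)) :
    ∃ S, IsRateMinimal s t R S := by
  obtain ⟨S, hS, hmin⟩ := Finset.exists_min_image
    (Finset.univ.filter fun S : Finset ι => S.Nonempty ∧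
      R * S.card ≤ Module.finrank (ZMod 2) (evenCode s t S)) Finset.card
    ⟨Finset.univ, by simpa [Finset.univ_nonempty] using h⟩
  simp only [Finset.mem_filter, Finset.mem_univ, true_and] at hS hmin
  refine ⟨S, hS.1, hS.2, fun S' hS' hss => not_le.1 fun hle => ?_⟩
  exact absurd (hmin S' ⟨hS', hle⟩) (not_le.2 (Finset.card_lt_card hss))

/-- Deleting an edge on which all codewords vanish keeps the dimension and lowers the size, against
minimality: there are no bridges. -/
lemma IsRateMinimal.exists_ne_zero {R : ℝ} (hR : 0 < R) {S : Finset ι} (hS : IsRateMinimal s t R S)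
    {e : ι} (he : e ∈ S) : ∃ z ∈ evenCode s t S, z e ≠ 0 := by
  by_contra! hcon
  have hle : evenCode s t S ≤ evenCode s t (S.erase e) := fun z hz => ⟨hz.1, fun e' he' => by
    by_cases h : e' = e
    · rw [h]; exact hcon z hz
    · exact hz.2 e' fun h' => he' (Finset.mem_erase.2 ⟨h, h'⟩)⟩
  have hpos : (0 : ℝ) < S.card := by exact_mod_cast hS.nonempty.card_pos
  have hfin : 0 < Module.finrank (ZMod 2) (evenCode s t S) := by
    have := lt_of_lt_of_le (mul_pos hR hpos) hS.le
    exact_mod_cast this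
  have : Nontrivial (evenCode s t S) := Module.nontrivial_of_finrank_pos hfin
  obtain ⟨⟨z, hz⟩, hz0⟩ := exists_ne (0 : evenCode s t S)
  have hne : (S.erase e).Nonempty := by
    by_contra hemp
    rw [Finset.not_nonempty_iff_eq_empty] at hemp
    refine hz0 (Subtype.ext (funext fun e' => (hle hz).2 e' ?_))
    simp [hemp]
  have h1 := hS.lt _ hne (Finset.erase_ssubset he)
  have h2 : (Module.finrank (ZMod 2) (evenCode s t S) : ℝ) ≤
      Module.finrank (ZMod 2) (evenCode s t (S.erase e)) := by
    exact_mod_cast Submodule.finrank_mono hle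
  have h3 : ((S.erase e).card : ℝ) ≤ S.card := by exact_mod_cast Finset.card_erase_le
  have := hS.le
  nlinarith

lemma restrict_mem_evenCode {S : Finset ι} {A : Set V} (hA : ∀ e ∈ S, s e ∈ A ↔ t e ∈ A)
    {z : ι → ZMod 2} (hz : z ∈ evenCode s t S) :
    (fun e => if s e ∈ A then z e else 0) ∈ evenCode s t (S.filter fun e => s e ∈ A) := by
  constructor
  · funext v
    rw [boundary_apply, Pi.zero_apply]
    by_cases hv : v ∈ A
    · refine Eq.trans (Finset.sum_congr rfl fun e _ => ?_) (congrFun hz.1 v)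
      by_cases heS : e ∈ S
      · by_cases he : s e ∈ A
        · rw [if_pos he]
        · have h1 : s e ≠ v := fun h => he (h ▸ hv)
          have h2 : t e ≠ v := fun h => he ((hA e heS).2 (h ▸ hv))
          simp [h1, h2]
      · simp [hz.2 e heS]
    · refine Finset.sum_eq_zero fun e _ => ?_
      by_cases heS : e ∈ S
      · by_cases he : s e ∈ A
        · have h1 : s e ≠ v := fun h => hv (h ▸ he)
          have h2 : t e ≠ v := fun h => hv (h ▸ (hA e heS).1 he)
          simp [h1, h2]
        · simp [he]
      · simp [hz.2 e heS]
  · intro e he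
    by_cases h : s e ∈ A
    · have : e ∉ S := fun h' => he (Finset.mem_filter.2 ⟨h', h⟩)
      simp [hz.2 e this]
    · simp [h]

/-- Across an empty cut the code splits as a direct sum. Both parts being proper and nonempty, both
would have rate below R, and hence so would the whole. -/
lemma IsRateMinimal.cut {R : ℝ} {S : Finset ι} (hS : IsRateMinimal s t R S)
    (A : Set V) (hA : ∀ e ∈ S, s e ∈ A ↔ t e ∈ A) : (∀ e ∈ S, s e ∈ A) ∨ ∀ e ∈ S, s e ∉ A := by
  by_contra! hcon
  obtain ⟨⟨e₂, h₂, h₂A⟩, e₁, h₁, h₁A⟩ := hcon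
  set S₁ := S.filter fun e => s e ∈ A with hS₁
  obtain ⟨B, hB⟩ : ∃ B : Set V, ∀ v, v ∈ B ↔ v ∉ A := ⟨Aᶜ, fun _ => Iff.rfl⟩
  set S₂ := S.filter fun e => s e ∈ B with hS₂
  have hle : evenCode s t S ≤ evenCode s t S₁ ⊔ evenCode s t S₂ := fun z hz => by
    rw [Submodule.mem_sup]
    refine ⟨_, restrict_mem_evenCode hA hz, _, restrict_mem_evenCode (A := B)
      (fun e he => by rw [hB, hB, hA e he]) hz, ?_⟩
    funext e
    by_cases h : s e ∈ A <;> simp [h, hB]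
  have hfin : Module.finrank (ZMod 2) (evenCode s t S) ≤
      Module.finrank (ZMod 2) (evenCode s t S₁) + Module.finrank (ZMod 2) (evenCode s t S₂) :=
    (Submodule.finrank_mono hle).trans (Submodule.finrank_add_le_finrank_add_finrank _ _)
  have hcard : S₁.card + S₂.card = S.card := by
    simp only [hS₁, hS₂, hB]
    exact Finset.card_filter_add_card_filter_not _
  have hlt₁ := hS.lt S₁ ⟨e₁, Finset.mem_filter.2 ⟨h₁, h₁A⟩⟩
    (Finset.ssubset_iff_subset_ne.2 ⟨Finset.filter_subset _ _, fun h =>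
      h₂A (Finset.mem_filter.1 (h.symm ▸ h₂ : e₂ ∈ S₁)).2⟩)
  have hlt₂ := hS.lt S₂ ⟨e₂, Finset.mem_filter.2 ⟨h₂, (hB _).2 h₂A⟩⟩
    (Finset.ssubset_iff_subset_ne.2 ⟨Finset.filter_subset _ _, fun h =>
      (hB _).1 (Finset.mem_filter.1 (h.symm ▸ h₁ : e₁ ∈ S₂)).2 h₁A⟩)
  have h1 := hS.le
  have h2 : (Module.finrank (ZMod 2) (evenCode s t S) : ℝ) ≤
      Module.finrank (ZMod 2) (evenCode s t S₁) + Module.finrank (ZMod 2) (evenCode s t S₂) := by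
    exact_mod_cast hfin
  have h3 : (S₁.card : ℝ) + S₂.card = S.card := by exact_mod_cast hcard
  have h4 : R * S₁.card + R * S₂.card = R * S.card := by rw [← mul_add, h3]
  linarith

end Minimal

/-! ### Contracting edges -/

section Contraction

variable {ι V : Type} [Fintype ι] {s t : ι → V}

lemma boundary_comp_eq_zero {W : Type} (f : V → W) {z : ι → ZMod 2} (hz : boundary s t z = 0) :
    boundary (f ∘ s) (f ∘ t) z = 0 := by
  funext w
  -- `V` may be infinite, so the fibre sums run over the finitely many ends of edges.
  set U : Finset V := Finset.univ.image s ∪ Finset.univ.image t with hU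
  have key : ∀ x ∈ U, (if f x = w then (1 : ZMod 2) else 0) =
      ∑ v ∈ U, (if x = v then 1 else 0) * (if f v = w then 1 else 0) := fun x hx => by
    simp only [ite_mul, one_mul, zero_mul, Finset.sum_ite_eq, if_pos hx]
  have hs : ∀ e, s e ∈ U := fun e =>
    Finset.mem_union_left _ (Finset.mem_image_of_mem _ (Finset.mem_univ e))
  have ht : ∀ e, t e ∈ U := fun e =>
    Finset.mem_union_right _ (Finset.mem_image_of_mem _ (Finset.mem_univ e))
  have h1 : boundary (f ∘ s) (f ∘ t) z w =
      ∑ v ∈ U, boundary s t z v * (if f v = w then 1 else 0) := by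
    simp only [boundary_apply, Function.comp_apply, Finset.sum_mul]
    rw [Finset.sum_comm]
    refine Finset.sum_congr rfl fun e _ => ?_
    rw [key _ (hs e), key _ (ht e), ← Finset.sum_add_distrib, Finset.mul_sum]
    exact Finset.sum_congr rfl fun v _ => by ring
  rw [h1, hz]
  simp

lemma boundary_merge {a b : V} (hab : a ≠ b) (y : ι → ZMod 2) (v : V) :
    boundary ((fun v => if v = b then a else v) ∘ s) ((fun v => if v = b then a else v) ∘ t) y v =
      if v = b then 0 else boundary s t y v + if v = a then boundary s t y b else 0 := by
  have key : ∀ x : V, (if (if x = b then a else x) = v then (1 : ZMod 2) else 0) =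
      if v = b then 0 else (if x = v then 1 else 0) + if v = a then (if x = b then 1 else 0) else 0 := by
    intro x
    by_cases h1 : v = b
    · subst h1
      by_cases h2 : x = v <;> simp [h2, hab]
    · by_cases h2 : v = a
      · subst h2
        by_cases h3 : x = b
        · subst h3; simp [hab, hab.symm]
        · simp [h3, hab]
      · by_cases h3 : x = b
        · subst h3; simp [h1, h2, Ne.symm h1, Ne.symm h2]
        · simp [h1, h2, h3]
  simp only [boundary_apply, Function.comp, key]
  by_cases h1 : v = b
  · simp [h1]
  · by_cases h2 : v = a
    · simp only [h2, hab, if_true, if_false]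
      rw [← Finset.sum_add_distrib]
      exact Finset.sum_congr rfl fun e _ => by ring
    · simp [h1, h2]

/-- Contracting `k` edges of a connected set `S` of edges, one after the other: `π` is the quotient
map, and the contracted edges form the forest `F`. -/
lemma exists_contraction {S : Finset ι}
    (hcut : ∀ A : Set V, (∀ e ∈ S, s e ∈ A ↔ t e ∈ A) → (∀ e ∈ S, s e ∈ A) ∨ ∀ e ∈ S, s e ∉ A)
    (k : ℕ) (hk : k + 1 ≤ (S.image s ∪ S.image t).card) :
    ∃ (π : V → V) (F : Finset ι), F ⊆ S ∧ F.card = k ∧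
      ((S.image s ∪ S.image t).image π).card + k = (S.image s ∪ S.image t).card ∧
      (∀ e ∈ F, π (s e) = π (t e)) ∧
      (∀ z : ι → ZMod 2, (∀ e ∉ F, z e = 0) → boundary s t z = 0 → z = 0) ∧
      ∀ y : ι → ZMod 2, (∀ e, e ∉ S ∨ e ∈ F → y e = 0) → boundary (π ∘ s) (π ∘ t) y = 0 →
        ∃ z, boundary s t z = 0 ∧ ∀ e ∉ F, z e = y e := by
  induction k with
  | zero =>
    exact ⟨id, ∅, by simp, rfl, by simp, by simp, fun z hz _ => funext fun e => hz e (by simp),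
      fun y _ hy => ⟨y, hy, fun _ _ => rfl⟩⟩
  | succ k ih =>
    obtain ⟨π, F, hFS, hFk, hcard, hloop, hacyc, hext⟩ := ih (by omega)
    set U := S.image s ∪ S.image t with hU
    -- If every edge were already a loop, a fibre of π would separate `S`.
    obtain ⟨e₀, he₀, hne⟩ : ∃ e ∈ S, π (s e) ≠ π (t e) := by
      by_contra! hcon
      obtain ⟨a, ha, b, hb, hab⟩ := Finset.one_lt_card.1 (by omega : 1 < (U.image π).card)
      have hrep : ∀ c ∈ U.image π, ∃ e ∈ S, π (s e) = c := by
        intro c hc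
        obtain ⟨v, hv, rfl⟩ := Finset.mem_image.1 hc
        rcases Finset.mem_union.1 hv with hv | hv <;> obtain ⟨e, he, rfl⟩ := Finset.mem_image.1 hv
        · exact ⟨e, he, rfl⟩
        · exact ⟨e, he, hcon e he⟩
      obtain ⟨e, he, hea⟩ := hrep a ha
      obtain ⟨e', he', heb⟩ := hrep b hb
      rcases hcut {v | π v = a} (fun e he => by
        simp only [Set.mem_ofPred_eq, hcon e he]) with h | h
      · exact hab ((h e' he').symm.trans heb)
      · exact h e he hea
    set a := π (s e₀) with ha
    set b := π (t e₀) with hb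
    have he₀F : e₀ ∉ F := fun h => hne (hloop e₀ h)
    refine ⟨(fun v => if v = b then a else v) ∘ π, insert e₀ F,
      Finset.insert_subset he₀ hFS, by rw [Finset.card_insert_of_notMem he₀F, hFk], ?_, ?_, ?_, ?_⟩
    · have h1 : U.image ((fun v => if v = b then a else v) ∘ π) = (U.image π).erase b := by
        rw [← Finset.image_image]
        ext v
        simp only [Finset.mem_image (s := U.image π), Finset.mem_erase]
        constructor
        · rintro ⟨w, hw, rfl⟩
          split_ifs with h
          · exact ⟨hne, Finset.mem_image_of_mem _
              (Finset.mem_union_left _ (Finset.mem_image_of_mem _ he₀))⟩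
          · exact ⟨h, hw⟩
        · rintro ⟨h, hv⟩
          exact ⟨v, hv, if_neg h⟩
      have h2 : b ∈ U.image π := Finset.mem_image_of_mem _
        (Finset.mem_union_right _ (Finset.mem_image_of_mem _ he₀))
      rw [h1, Finset.card_erase_of_mem h2]
      have := Finset.card_pos.2 ⟨b, h2⟩
      omega
    · intro e he
      rcases Finset.mem_insert.1 he with rfl | he
      · simp only [Function.comp, ← ha, ← hb, if_true, if_neg hne]
      · simp only [Function.comp, hloop e he]
    · intro z hz hzb
      -- After contraction by π the edges of `F` are loops, so `e₀` alone contributes at a; its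
      -- coefficient vanishes.
      have h1 := congrFun (boundary_comp_eq_zero π hzb) a
      rw [boundary_apply, Finset.sum_eq_single e₀] at h1
      · have h2 : z e₀ = 0 := by
          simpa [Function.comp, ← ha, ← hb, hne.symm] using h1
        refine hacyc z (fun e he => ?_) hzb
        by_cases h : e = e₀
        · rw [h, h2]
        · exact hz e (by simp [h, he])
      · intro e _ hee
        by_cases he : e ∈ F
        · simp only [Function.comp, hloop e he, CharTwo.add_self_eq_zero, mul_zero]
        · rw [hz e (by simp [hee, he]), zero_mul]
      · simp
    · intro y hy hyb
      have hm : ∀ v, (if v = b then 0 else boundary (π ∘ s) (π ∘ t) y v +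
          if v = a then boundary (π ∘ s) (π ∘ t) y b else 0) = 0 := fun v => by
        rw [← boundary_merge hne]; exact congrFun hyb v
      have hy₀ : y e₀ = 0 := hy e₀ (Or.inr (Finset.mem_insert_self _ _))
      -- Before the last merge, y may have boundary c at both a and b; adding c times `e₀` cancels
      -- it.
      set c := boundary (π ∘ s) (π ∘ t) y b with hc
      obtain ⟨z, hz, hzy⟩ := hext (y + c • Pi.single e₀ 1) (fun e he => by
          have h1 : e ≠ e₀ := by
            rintro rfl
            rcases he with he | he
            · exact he he₀
            · exact he₀F he
          have h2 : y e = 0 := hy e (he.imp_right fun h => Finset.mem_insert_of_mem h)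
          simp [h1, h2]) (by
        rw [map_add, map_smul, boundary_single]
        funext v
        have hmv := hm v
        simp only [Pi.add_apply, Pi.smul_apply, Function.comp_apply, ← ha, ← hb, Pi.single_apply,
          smul_eq_mul, Pi.zero_apply]
        by_cases h1 : v = b
        · subst h1
          simp [hne.symm, ← hc, CharTwo.add_self_eq_zero]
        · rw [if_neg h1] at hmv
          by_cases h2 : v = a
          · subst h2; simpa [hne] using hmv
          · simpa [h1, h2] using hmv)
      refine ⟨z, hz, fun e he => ?_⟩
      rw [Finset.mem_insert, not_or] at he
      rw [hzy e he.2]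
      simp [he.1]

end Contraction

/-! ### Contracting a code of high rate to a dense graph -/

section DenseContraction

variable {ι V : Type} [Fintype ι] {s t : ι → V}

lemma boundary_congr {s' t' : ι → V} {y : ι → ZMod 2} (hs : ∀ e, y e ≠ 0 → s e = s' e)
    (ht : ∀ e, y e ≠ 0 → t e = t' e) : boundary s t y = boundary s' t' y := by
  funext v
  rw [boundary_apply, boundary_apply]
  refine Finset.sum_congr rfl fun e _ => ?_
  by_cases h : y e = 0
  · simp [h]
  · rw [hs e h, ht e h]

lemma hammingNorm_le_add_of_eqOn_compl {z y : ι → ZMod 2} {F : Finset ι} (h : ∀ e ∉ F, z e = y e) :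
    hammingNorm z ≤ F.card + hammingNorm y := by
  refine le_trans (Finset.card_le_card fun e he => ?_) (Finset.card_union_le _ _)
  by_cases hF : e ∈ F
  · exact Finset.mem_union_left _ hF
  · refine Finset.mem_union_right _ ?_
    simp only [Finset.mem_filter, Finset.mem_univ, true_and] at he ⊢
    rw [← h e hF]; exact he

lemma hammingNorm_single_le (e : ι) : hammingNorm (Pi.single e 1 : ι → ZMod 2) ≤ 1 := by
  rw [hammingNorm, ← Finset.card_singleton e]
  refine Finset.card_le_card fun e' he' => ?_
  by_contra h
  simp only [Finset.mem_singleton] at h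
  simp [h] at he'

lemma hammingNorm_add_le (x y : ι → ZMod 2) :
    hammingNorm (x + y) ≤ hammingNorm x + hammingNorm y := by
  refine le_trans (Finset.card_le_card fun e he => ?_) (Finset.card_union_le _ _)
  simp only [Finset.mem_union, Finset.mem_filter, Finset.mem_univ, true_and, Pi.add_apply] at he ⊢
  by_contra! h
  exact he (by rw [h.1, h.2, add_zero])

/-- Codewords are determined by their values off the forest `F`. -/
lemma finrank_evenCode_le {S F : Finset ι} (hFS : F ⊆ S)
    (hacyc : ∀ z : ι → ZMod 2, (∀ e ∉ F, z e = 0) → boundary s t z = 0 → z = 0) :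
    Module.finrank (ZMod 2) (evenCode s t S) + F.card ≤ S.card := by
  let f : evenCode s t S →ₗ[ZMod 2] ({e // e ∈ S \ F} → ZMod 2) :=
    (LinearMap.funLeft (ZMod 2) (ZMod 2) (fun e : {e // e ∈ S \ F} => (e : ι))).comp
      (evenCode s t S).subtype
  have hf : Function.Injective f := by
    rw [injective_iff_map_eq_zero]
    intro z hz
    refine Subtype.ext (hacyc _ (fun e he => ?_) z.2.1)
    by_cases heS : e ∈ S
    · exact congrFun hz ⟨e, Finset.mem_sdiff.2 ⟨heS, he⟩⟩
    · exact z.2.2 e heS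
  have := LinearMap.finrank_le_finrank_of_injective hf
  rw [Module.finrank_fintype_fun_eq_card, Fintype.card_coe, Finset.card_sdiff_of_subset hFS] at this
  have := Finset.card_le_card hFS
  omega

/-- From an edge system of rate at least `R` without even sets of size at most `L`, contracting `k`
edges of a suitable connected part yields a dense simple graph on at least `N` vertices, whose even
sets lift after adding contracted edges. -/
theorem exists_dense_contraction [Nonempty ι] {R : ℝ} (hR0 : 0 < R) (hR1 : R < 1) {k L N : ℕ}
    (hk : 1 ≤ R * k) (hL : k + 2 ≤ L) (hN : k + N ≤ L)
    (hrate : R * Fintype.card ι ≤ Module.finrank (ZMod 2) (evenCode s t Finset.univ))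
    (hmin : ∀ z, boundary s t z = 0 → z ≠ 0 → L < hammingNorm z) :
    ∃ n, N ≤ n ∧ ∃ G ∈ denseGraphs (2 / (1 - R)) n, ∃ (s' t' : ι → Fin n) (lab : G.Dart → ι),
      (∀ d, s(s' (lab d), t' (lab d)) = d.edge) ∧
      ∀ y : ι → ZMod 2, (∀ e ∉ Set.range lab, y e = 0) → boundary s' t' y = 0 →
        ∃ z, boundary s t z = 0 ∧ ∃ F : Finset ι, F.card ≤ k ∧ (∀ e ∉ F, z e = y e) ∧
          ∀ e ∈ F, y e = 0 := by
  obtain ⟨S, hS⟩ := exists_isRateMinimal hrate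
  set U := S.image s ∪ S.image t with hU
  have hU1 : 1 ≤ U.card := Finset.card_pos.2
    ((hS.nonempty.image s).mono Finset.subset_union_left)
  have hSpos : (0 : ℝ) < S.card := by exact_mod_cast hS.nonempty.card_pos
  -- Contracting a spanning tree gives the dimension bound. A fundamental cycle has at most |U|
  -- edges, so the lack of short codewords gives L < |U|.
  have hdim : Module.finrank (ZMod 2) (evenCode s t S) + U.card ≤ S.card + 1 ∧ L < U.card := by
    obtain ⟨π, F, hFS, hFk, hcard, hloop, hacyc, hext⟩ :=
      exists_contraction hS.cut (U.card - 1) (by rw [← hU]; omega)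
    have h1 := finrank_evenCode_le hFS hacyc
    refine ⟨by omega, ?_⟩
    have h2 : 0 < Module.finrank (ZMod 2) (evenCode s t S) := by
      have := lt_of_lt_of_le (mul_pos hR0 hSpos) hS.le
      exact_mod_cast this
    obtain ⟨e, he⟩ : (S \ F).Nonempty := by
      rw [← Finset.card_pos, Finset.card_sdiff_of_subset hFS]; omega
    rw [Finset.mem_sdiff] at he
    have h3 : (U.image π).card = 1 := by rw [← hU] at hcard; omega
    obtain ⟨a, ha⟩ := Finset.card_eq_one.1 h3
    have h4 : ∀ v ∈ U, π v = a := fun v hv =>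
      Finset.mem_singleton.1 (ha ▸ Finset.mem_image_of_mem π hv)
    obtain ⟨z, hz, hzy⟩ := hext (Pi.single e 1) (fun e' he' => by
      have : e' ≠ e := by
        rintro rfl; rcases he' with h | h
        · exact h he.1
        · exact he.2 h
      simp [this]) (by
      rw [boundary_single, Function.comp_apply, Function.comp_apply,
        h4 _ (Finset.mem_union_left _ (Finset.mem_image_of_mem _ he.1)),
        h4 _ (Finset.mem_union_right _ (Finset.mem_image_of_mem _ he.1)), add_self_zmod_two])
    have hz0 : z ≠ 0 := by
      rintro rfl
      have := hzy e he.2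
      simp at this
    have h5 := hmin z hz hz0
    have h6 := hammingNorm_le_add_of_eqOn_compl hzy
    have h7 := hammingNorm_single_le e
    omega
  obtain ⟨hdim, hLU⟩ := hdim
  obtain ⟨π, F, hFS, hFk, hcard, hloop, -, hext⟩ := exists_contraction hS.cut k (by rw [← hU]; omega)
  rw [← hU] at hcard
  set n := (U.image π).card with hn
  have hn2 : 2 ≤ n := by omega
  have hsU : ∀ e ∈ S, s e ∈ U := fun e he =>
    Finset.mem_union_left _ (Finset.mem_image_of_mem _ he)
  have htU : ∀ e ∈ S, t e ∈ U := fun e he =>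
    Finset.mem_union_right _ (Finset.mem_image_of_mem _ he)
  -- Number the contracted vertices by `Fin n`, with a junk value away from them; g undoes the
  -- numbering.
  obtain ⟨τ, g, hgτ, hsurj⟩ : ∃ (τ : V → Fin n) (g : Fin n → V), (∀ v ∈ U, g (τ v) = π v) ∧
      (∀ a, ∃ v ∈ U, τ v = a) ∧ ∀ u v, π u = π v → τ u = τ v := by
    refine ⟨fun v => if h : π v ∈ U.image π then (U.image π).equivFin ⟨π v, h⟩ else ⟨0, by omega⟩,
      fun a => ((U.image π).equivFin.symm a).1, fun v hv => ?_, fun a => ?_, fun u v huv => ?_⟩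
    · simp only [dif_pos (Finset.mem_image_of_mem π hv), Equiv.symm_apply_apply]
    · obtain ⟨⟨w, hw⟩, rfl⟩ := (U.image π).equivFin.surjective a
      obtain ⟨v, hv, rfl⟩ := Finset.mem_image.1 hw
      exact ⟨v, hv, dif_pos hw⟩
    · simp only [huv]
  obtain ⟨hsurj, hτπ⟩ := hsurj
  have hlift : ∀ y : ι → ZMod 2, (∀ e ∉ S \ F, y e = 0) → boundary (τ ∘ s) (τ ∘ t) y = 0 →
      ∃ z, boundary s t z = 0 ∧ ∀ e ∉ F, z e = y e := by
    intro y hy hyb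
    refine hext y (fun e he => hy e fun h => ?_) ?_
    · rw [Finset.mem_sdiff] at h
      rcases he with he | he
      · exact he h.1
      · exact h.2 he
    · rw [← boundary_comp_eq_zero g hyb]
      have hyS : ∀ e, y e ≠ 0 → e ∈ S := fun e he => by
        by_contra h
        exact he (hy e fun h' => h (Finset.mem_sdiff.1 h').1)
      exact boundary_congr (fun e he => (hgτ _ (hsU e (hyS e he))).symm)
        fun e he => (hgτ _ (htU e (hyS e he))).symm
  -- A loop or a pair of parallel edges would lift to a nonzero codeword of weight at most k + 2 ≤
  -- L.
  have hheavy : ∀ y : ι → ZMod 2, (∀ e ∉ S \ F, y e = 0) → boundary (τ ∘ s) (τ ∘ t) y = 0 →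
      hammingNorm y ≤ 2 → y = 0 := by
    intro y hy hyb hy2
    obtain ⟨z, hz, hzy⟩ := hlift y hy hyb
    by_contra hy0
    obtain ⟨e, he⟩ := Function.ne_iff.1 hy0
    have heF : e ∉ F := fun h => he (hy e fun h' => (Finset.mem_sdiff.1 h').2 h)
    have := hmin z hz (fun h => he (by rw [← hzy e heF, h]))
    have := hammingNorm_le_add_of_eqOn_compl hzy
    omega
  have hsupp : ∀ e ∈ S \ F, ∀ e' ∉ S \ F, (Pi.single e 1 : ι → ZMod 2) e' = 0 := by
    intro e he e' he'
    have : e' ≠ e := by rintro rfl; exact he' he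
    simp [this]
  have : Nontrivial (Fin n) := Fin.nontrivial_iff_two_le.2 hn2
  obtain ⟨G, hconn, hdeg, hsum, lab, hlabE, hlab⟩ :=
    exists_connected_graph (s := τ ∘ s) (t := τ ∘ t) (E := S \ F) (by
      intro A hA
      rcases hS.cut (τ ⁻¹' A) (fun e he => by
        by_cases heF : e ∈ F
        · simp only [Set.mem_preimage, hτπ _ _ (hloop e heF)]
        · exact hA e (Finset.mem_sdiff.2 ⟨he, heF⟩)) with h | h
      · right
        refine Set.eq_univ_of_forall fun a => ?_
        obtain ⟨v, hv, rfl⟩ := hsurj a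
        rcases Finset.mem_union.1 hv with hv | hv <;>
          obtain ⟨e, he, rfl⟩ := Finset.mem_image.1 hv
        · exact h e he
        · by_cases heF : e ∈ F
          · rw [← hτπ _ _ (hloop e heF)]; exact h e he
          · exact (hA e (Finset.mem_sdiff.2 ⟨he, heF⟩)).1 (h e he)
      · left
        refine Set.eq_empty_of_forall_notMem fun a ha => ?_
        obtain ⟨v, hv, rfl⟩ := hsurj a
        rcases Finset.mem_union.1 hv with hv | hv <;>
          obtain ⟨e, he, rfl⟩ := Finset.mem_image.1 hv
        · exact h e he ha
        · by_cases heF : e ∈ F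
          · rw [← hτπ _ _ (hloop e heF)] at ha; exact h e he ha
          · exact h e he ((hA e (Finset.mem_sdiff.2 ⟨he, heF⟩)).2 ha)) (by
      intro e he h
      have := hheavy (Pi.single e 1) (hsupp e he) (by rw [boundary_single, h, add_self_zmod_two])
        ((hammingNorm_single_le e).trans (by norm_num))
      simpa using congrFun this e) (by
      intro e he e' he' h
      by_contra hne
      have := hheavy (Pi.single e 1 + Pi.single e' 1) (fun f hf => by
          rw [Pi.add_apply, hsupp e he f hf, hsupp e' he' f hf, add_zero]) (by
        rw [map_add, boundary_single, boundary_single]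
        have hcomm : ∀ f g : Fin n → ZMod 2, f + g + (g + f) = 0 := fun f g => by
          rw [add_comm g f, add_self_zmod_two]
        rcases Sym2.eq_iff.1 h with ⟨h1, h2⟩ | ⟨h1, h2⟩ <;> rw [h1, h2]
        · rw [add_self_zmod_two]
        · exact hcomm _ _)
        ((hammingNorm_add_le _ _).trans
          (add_le_add (hammingNorm_single_le e) (hammingNorm_single_le e')))
      have h2 := congrFun this e
      simp [hne] at h2) (by
      intro e he
      obtain ⟨z, hz, hze⟩ := hS.exists_ne_zero hR0 (Finset.mem_sdiff.1 he).1
      refine ⟨fun e => if e ∈ S \ F then z e else 0, fun e' he' => if_neg he', ?_, ?_⟩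
      · rw [← boundary_comp_eq_zero τ hz.1]
        funext v
        rw [boundary_apply, boundary_apply]
        refine Finset.sum_congr rfl fun f _ => ?_
        by_cases hf : f ∈ S \ F
        · rw [if_pos hf]
        · rw [if_neg hf]
          by_cases hfS : f ∈ S
          · have hfF : f ∈ F := by
              by_contra h; exact hf (Finset.mem_sdiff.2 ⟨hfS, h⟩)
            rw [Function.comp_apply, Function.comp_apply, hτπ _ _ (hloop f hfF),
              CharTwo.add_self_eq_zero, mul_zero, mul_zero]
          · rw [hz.2 f hfS]
      · simpa only [if_pos he] using hze)
  have hG : G ∈ denseGraphs (2 / (1 - R)) n := by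
    refine ⟨hconn, ?_, hdeg⟩
    have hn0 : (0 : ℝ) < n := by exact_mod_cast (by omega : 0 < n)
    have hR : 0 < 1 - R := by linarith
    rw [le_div_iff₀ hn0, div_mul_eq_mul_div, div_le_iff₀ hR]
    have h1 : (2 : ℝ) * (S.card - k) ≤ ∑ v, (G.degree v : ℝ) := by
      rw [Finset.card_sdiff_of_subset hFS, hFk] at hsum
      have h2 : k ≤ S.card := hFk ▸ Finset.card_le_card hFS
      have h3 : ((2 * (S.card - k) : ℕ) : ℝ) ≤ ((∑ v, G.degree v : ℕ) : ℝ) := by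
        exact_mod_cast hsum
      push_cast [Nat.cast_sub h2] at h3
      exact h3
    have h4 : (Module.finrank (ZMod 2) (evenCode s t S) : ℝ) + U.card ≤ S.card + 1 := by
      exact_mod_cast hdim
    have h5 : (n : ℝ) + k = U.card := by exact_mod_cast hcard
    have h6 := hS.le
    -- From |U| ≤ (1-R)|S| + 1 and Rk ≥ 1 follows n = |U| - k ≤ (1-R)(|S| - k): the k contracted
    -- edges absorb the additive 1.
    nlinarith
  refine ⟨n, by omega, G, hG, τ ∘ s, τ ∘ t, lab, hlab, fun y hy hyb => ?_⟩
  have hy' : ∀ e ∉ S \ F, y e = 0 := fun e he => hy e (by rintro ⟨d, rfl⟩; exact he (hlabE d))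
  obtain ⟨z, hz, hzy⟩ := hlift y hy' hyb
  exact ⟨z, hz, F, hFk.le, hzy, fun e he => hy' e fun h => (Finset.mem_sdiff.1 h).2 he⟩

end DenseContraction

/-! ### Cycle codes above the threshold -/

section Threshold

lemma exists_cycleCode_eq_ker_boundary {V ι : Type} [Fintype ι] (G : Graph V ι)
    (hG : G.edgeSet = Set.univ) :
    ∃ s t : ι → V, ∀ x, x ∈ cycleCode G ↔ boundary s t x = 0 := by
  have h : ∀ e : ι, ∃ a b, G.IsLink e a b := fun e =>
    (G.edge_mem_iff_exists_isLink e).1 (hG.symm ▸ Set.mem_univ e : e ∈ G.edgeSet)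
  choose s t hst using h
  have key : ∀ e v, ((if s e = v then 1 else 0) + (if t e = v then 1 else 0) : ZMod 2) =
      if G.IsNonloopAt e v then 1 else 0 := by
    intro e v
    by_cases h1 : s e = v <;> by_cases h2 : t e = v
    · rw [if_pos h1, if_pos h2, if_neg, CharTwo.add_self_eq_zero]
      rintro ⟨w, hw, hl⟩
      rcases (hst e).eq_and_eq_or_eq_and_eq hl with ⟨-, h⟩ | ⟨h, -⟩
      · exact hw (h.symm.trans h2)
      · exact hw (h.symm.trans h1)
    · rw [if_pos h1, if_neg h2, if_pos, add_zero]
      exact ⟨t e, h2, h1 ▸ hst e⟩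
    · rw [if_neg h1, if_pos h2, if_pos, zero_add]
      exact ⟨s e, h1, h2 ▸ (hst e).symm⟩
    · rw [if_neg h1, if_neg h2, if_neg, add_zero]
      rintro ⟨w, hw, hl⟩
      rcases (hst e).eq_and_eq_or_eq_and_eq hl with ⟨h, -⟩ | ⟨-, h⟩
      · exact h1 h
      · exact h2 h
  refine ⟨s, t, fun x => ?_⟩
  rw [funext_iff]
  refine forall_congr' fun v => ?_
  rw [boundary_apply, Pi.zero_apply, Finset.sum_filter]
  simp only [key, mul_ite, mul_one, mul_zero]

/-- Each edge added in lifting a cycle costs at most 1. -/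
lemma excess_sub_le {ι : Type} [Fintype ι] (x : ι → ZMod 2) {y z : ι → ZMod 2} {F : Finset ι}
    (hz : ∀ e ∉ F, z e = y e) (hy : ∀ e ∈ F, y e = 0) : excess x y - F.card ≤ excess x z := by
  have h1 : (F.card : ℤ) = ∑ e : ι, if e ∈ F then 1 else 0 := by simp
  rw [excess, excess, Finset.sum_filter, Finset.sum_filter, h1, ← Finset.sum_sub_distrib]
  refine Finset.sum_le_sum fun e _ => ?_
  by_cases he : e ∈ F
  · rw [if_pos he, hy e he]; split_ifs <;> simp_all
  · rw [if_neg he, hz e he, sub_zero]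

lemma exists_degree_ne_two {μ : ℝ} (hμ : 2 < μ) {n : ℕ} {G : SimpleGraph (Fin n)}
    (hG : G ∈ denseGraphs μ n) : ∃ v, G.degree v ≠ 2 := by
  by_contra! h
  have h1 := hG.2.1
  have := hG.1.nonempty
  have hn : (0 : ℝ) < n := by exact_mod_cast Fin.pos_iff_nonempty.2 this
  simp only [h, Finset.sum_const, Finset.card_univ, Fintype.card_fin, nsmul_eq_mul] at h1
  rw [le_div_iff₀ hn] at h1
  push_cast at h1
  nlinarith

/-- Slightly perturbed parameters keep the branching supercritical. -/
lemma exists_supercritical_parameters {p l : ℝ} (hp : 0 < p)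
    (h : 1 < l * (2 * Real.sqrt (p * (1 - p)))) :
    ∃ (H : ℕ) (p' l' : ℝ), 0 < p' ∧ p' < p ∧ l - 1 ≤ l' ∧ l' < l ∧
      1 < l' * (2 * Real.sqrt (p' * (1 - p')) * (1 - 1 / (H + 1))) := by
  have h0 := tendsto_one_div_add_atTop_nhds_zero_nat (𝕜 := ℝ)
  -- One integer m perturbs all three parameters, with H = m; continuity preserves the strict
  -- inequality.
  have h1 : Filter.Tendsto (fun m : ℕ => (l - 1 / ((m : ℝ) + 1)) *
      (2 * Real.sqrt ((p * (1 - 1 / ((m : ℝ) + 1))) * (1 - p * (1 - 1 / ((m : ℝ) + 1)))) *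
        (1 - 1 / ((m : ℝ) + 1)))) Filter.atTop
      (nhds ((l - 0) * (2 * Real.sqrt ((p * (1 - 0)) * (1 - p * (1 - 0))) * (1 - 0)))) := by
    have ha : Filter.Tendsto (fun m : ℕ => p * (1 - 1 / ((m : ℝ) + 1))) Filter.atTop
        (nhds (p * (1 - 0))) := (h0.const_sub 1).const_mul p
    exact (h0.const_sub l).mul
      ((((ha.mul (ha.const_sub 1)).sqrt).const_mul 2).mul (h0.const_sub 1))
  simp only [sub_zero, mul_one] at h1
  obtain ⟨m, hm, hm1⟩ := ((h1.eventually (lt_mem_nhds h)).and (Filter.eventually_ge_atTop 1)).exists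
  have hm0 : (0 : ℝ) < 1 / ((m : ℝ) + 1) := by positivity
  have hmlt : 1 / ((m : ℝ) + 1) < 1 := by
    rw [div_lt_one (by positivity)]
    have : (1 : ℝ) ≤ m := by exact_mod_cast hm1
    linarith
  refine ⟨m, p * (1 - 1 / ((m : ℝ) + 1)), l - 1 / ((m : ℝ) + 1), mul_pos hp (by linarith), ?_,
    by linarith, by linarith, hm⟩
  nlinarith

/-- Above the threshold, the error probability of the cycle codes of rate at least `R` is bounded
below. -/
theorem exists_le_prodMass_heavySet {R p : ℝ} (hR : R ∈ Set.Ioo (0 : ℝ) 1) (hp0 : 0 < p)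
    (hp1 : p < 1) (h : 1 < lambdaStar (2 / (1 - R)) * (2 * Real.sqrt (p * (1 - p)))) :
    ∃ ε > 0, ∀ C ∈ cycleCodes, R ≤ C.rate →
      ε ≤ prodMass (fun _ => errWeight p) (heavySet C.code 0) := by
  obtain ⟨hR0, hR1⟩ := hR
  obtain ⟨H, p', l', hp'0, hp'p, hl'1, hl', ha⟩ := exists_supercritical_parameters hp0 h
  have hl'0 : 0 ≤ l' := by linarith [one_le_lambdaStar (2 / (1 - R))]
  set a := l' * (2 * Real.sqrt (p' * (1 - p')) * (1 - 1 / (H + 1))) with ha_def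
  obtain ⟨N, hN⟩ := Filter.eventually_atTop.1 (eventually_lt_lambdaStarAt hl')
  set k := ⌈1 / R⌉₊ with hk
  have hk1 : 1 ≤ R * k := by
    have := Nat.le_ceil (1 / R)
    rwa [div_le_iff₀ hR0, mul_comm] at this
  have hp'1 : 0 < 1 - p' := by linarith
  set r := (p - p') / (1 - p') with hr
  have hr0 : 0 < r := div_pos (by linarith) hp'1
  have hr1 : r ≤ 1 := (div_le_one hp'1).2 (by linarith)
  have hpr : p' + (1 - p') * r = p := by rw [hr, mul_div_cancel₀ _ hp'1.ne']; ring
  -- Length k + 2 makes the contraction simple, and k + N leaves at least N vertices.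
  set L := k + 2 + N with hL
  -- The deficiency 2H + 5 of the explored cycle, plus at most k for lifting it.
  set M := 2 * H + 5 + k with hM
  refine ⟨min (p ^ L) (r ^ M * ((a - 1) / a)), lt_min (pow_pos hp0 _)
    (mul_pos (pow_pos hr0 _) (div_pos (by linarith) (by linarith))), ?_⟩
  rintro C ⟨V, G, -, hGe, hCG⟩ hrate
  obtain ⟨s, t, hst⟩ := exists_cycleCode_eq_ker_boundary G hGe
  rw [← hCG] at hst
  by_cases hshort : ∃ z ∈ C.code, z ≠ 0 ∧ hammingNorm z ≤ L
  · obtain ⟨z, hz, hz0, hzL⟩ := hshort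
    exact (min_le_left _ _).trans (pow_le_prodMass_heavySet C.code hp0.le hp1.le hz hz0 hzL)
  push Not at hshort
  refine (min_le_right _ _).trans ?_
  have hcard : (Fintype.card C.ι : ℝ) ≠ 0 := by
    intro h0
    rw [BinaryLinearCode.rate, h0, div_zero] at hrate
    linarith
  have hne : Nonempty C.ι := Fintype.card_pos_iff.1 (Nat.pos_of_ne_zero (by exact_mod_cast hcard))
  have heven : evenCode s t Finset.univ = C.code := by
    ext x
    rw [hst]
    exact ⟨fun hx => hx.1, fun hx => ⟨hx, fun e he => absurd (Finset.mem_univ e) he⟩⟩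
  have hrate' : R * Fintype.card C.ι ≤ Module.finrank (ZMod 2) (evenCode s t Finset.univ) := by
    rw [heven]
    rwa [BinaryLinearCode.rate, le_div_iff₀ (lt_of_le_of_ne (Nat.cast_nonneg _) hcard.symm)] at hrate
  obtain ⟨n, hn, Γ, hΓ, s', t', lab, hlab, hlift⟩ := exists_dense_contraction (s := s) (t := t)
    hR0 hR1 hk1 (by omega : k + 2 ≤ L) (by omega : k + N ≤ L) hrate'
    fun z hz hz0 => hshort z ((hst z).2 hz) hz0
  have hμ : 2 < 2 / (1 - R) := by
    rw [lt_div_iff₀ (by linarith)]; linarith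
  obtain ⟨l, hl⟩ := exists_isPerronEigenvalue_nonBacktrackingMatrix hΓ.1 hΓ.2.2
    (exists_degree_ne_two hμ hΓ)
  have hl'l : l' ≤ l := (hN n hn).le.trans (lambdaStarAt_le hΓ hl)
  obtain ⟨w, hw0, hw⟩ := hl.sum_succDarts
  have := hΓ.1.nonempty
  have := nonempty_dart_of_degree hΓ.2.2
  have hH : (0 : ℝ) ≤ 1 - 1 / (H + 1) := by
    rw [sub_nonneg, div_le_one (by positivity)]; linarith [(Nat.cast_nonneg H : (0 : ℝ) ≤ H)]
  have hmass := le_prodMass_of_supercritical (H := H) hlab hp'0 (by linarith)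
    (A := heavySet C.code M) (fun x y hy0 hy hyb hex => by
      obtain ⟨z, hz, F, hF, hzy, hyF⟩ := hlift y hy hyb
      refine ⟨z, (hst z).2 hz, ?_, ?_⟩
      · rintro rfl
        refine hy0 (funext fun e => ?_)
        by_cases he : e ∈ F
        · exact hyF e he
        · exact (hzy e he).symm
      · have := excess_sub_le x hzy hyF
        rw [hM]
        push_cast at hex ⊢
        have : (F.card : ℤ) ≤ k := by exact_mod_cast hF
        linarith)
    hw0 (hl'0.trans hl'l) hw ha (mul_le_mul_of_nonneg_right hl'l (by positivity))
  rw [← hpr]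
  exact (mul_le_mul_of_nonneg_left hmass (pow_nonneg hr0.le _)).trans
    (pow_mul_prodMass_heavySet_le C.code M hp'0.le (by linarith) hr0.le hr1)

end Threshold

end CycleCodeThreshold
end

theorem theorem3 (R : ℝ) (hR : R ∈ Set.Ioo (0 : ℝ) 1) :
    (∃! θ : ℝ, CycleCodeThreshold.IsMLThreshold CycleCodeThreshold.cycleCodes R θ) ∧
    ∀ θ : ℝ, CycleCodeThreshold.IsMLThreshold CycleCodeThreshold.cycleCodes R θ →
      θ ≤ 1 / 2 *
        (1 - Real.sqrt (1 - 1 / CycleCodeThreshold.lambdaStar (2 / (1 - R)) ^ 2)) := by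
  refine ⟨CycleCodeThreshold.existsUnique_isMLThreshold _ R, fun θ hθ => ?_⟩
  set l := CycleCodeThreshold.lambdaStar (2 / (1 - R)) with hl
  have hl1 : 1 ≤ l := CycleCodeThreshold.one_le_lambdaStar _
  have hsq : 1 / l ^ 2 ≤ 1 := (div_le_one (by positivity)).2 (one_le_pow₀ hl1)
  set σ := Real.sqrt (1 - 1 / l ^ 2) with hσ
  have hσ0 : 0 ≤ σ := Real.sqrt_nonneg _
  have hσ2 : σ ^ 2 = 1 - 1 / l ^ 2 := Real.sq_sqrt (by linarith)
  have hσ1 : σ ≤ 1 := Real.sqrt_le_one.2 (by linarith [(by positivity : 0 ≤ 1 / l ^ 2)])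
  by_contra! hlt
  obtain ⟨p, hp, hpθ⟩ := exists_between hlt
  have hθ2 := hθ.mem_Icc.2
  have hp0 : 0 < p := lt_of_le_of_lt (by linarith) hp
  -- Since (1-σ)/2 < p < 1/2, one has (1-2p)² < σ² = 1 - 1/l².
  have h4 : 1 / l ^ 2 < 4 * (p * (1 - p)) := by nlinarith
  have hcrit : 1 < l * (2 * Real.sqrt (p * (1 - p))) := by
    rw [div_lt_iff₀ (by positivity)] at h4
    have h5 : Real.sqrt (p * (1 - p)) ^ 2 = p * (1 - p) := Real.sq_sqrt (by nlinarith)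
    have h6 : 1 < (l * (2 * Real.sqrt (p * (1 - p)))) ^ 2 := by
      rw [mul_pow, mul_pow, h5]; linarith
    exact (one_lt_sq_iff₀ (by positivity)).1 h6
  obtain ⟨ε, hε, hC⟩ := CycleCodeThreshold.exists_le_prodMass_heavySet hR hp0 (by linarith) hcrit
  obtain ⟨C, hCc, hrate, herr⟩ := hθ.below p ⟨hp0, hpθ⟩ (ε / 2) (by linarith)
  have h1 := herr 0 C.code.zero_mem
  rw [CycleCodeThreshold.mlErrorProb_eq C hp0 (by linarith) C.code.zero_mem] at h1
  linarith [hC C hCc hrate]
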